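/- **Definitions.** *Skew Boolean algebras.* A *skew lattice* is a set $S$ with associative idempotent operations $\wedge,\vee$ satisfying $x\wedge(x\vee y)=x=x\vee(x\wedge y)$ and $(y\vee x)\wedge x=x=(y\wedge x)\vee x$; its natural partial order is $x\le y\iff x\wedge y=y\wedge x=x$. A *left-handed skew Boolean algebra* is an algebra $(S;\wedge,\vee,\setminus,0)$ such that $(S;\wedge,\vee)$ is a skew lattice that is left-handed ($x\wedge y\wedge x=x\wedge y$, $x\vee y\vee x=y\vee x$) and symmetric ($x\vee y=y\vee x\iff x\wedge y=y\wedge x$), $0$ is a zero ($x\wedge 0=0\wedge x=0$), every principal subalgebra $\lceil x\rceil=\{u: u\le x\}$ is a Boolean lattice, and $a\setminus b$ is the complement of $a\wedge b\wedge a$ in $\lceil a\rceil$. Let $x\,\mathcal D\,y$ mean $x\wedge y\wedge x=x$ and $y\wedge x\wedge y=y$; then $S/\mathcal D$ is a generalized Boolean algebra (the maximal lattice image of $S$), with projection $\alpha:S\to S/\mathcal D$. A homomorphism $k:S\to T$ (preserving $\wedge,\vee,\setminus,0$) is *proper* if for the induced map $\overline k:S/\mathcal D\to T/\mathcal D$ every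 element of $T/\mathcal D$ lies below some element of the image of $\overline k$. Let $\mathbf{SkewB}$ be the category of left-handed skew Boolean algebras and proper homomorphisms. A left-handed *skew Boolean $\cap$-algebra* is a left-handed skew Boolean algebra in which every nonempty finite set has a greatest lower bound for $\le$; $a\cap b$ denotes the greatest lower bound of $\{a,b\}$. Let $\mathbf{LSBIA}$ be the category of left-handed skew Boolean $\cap$-algebras and proper homomorphisms that preserve $\cap$. *Étale spaces.* A *locally compact Boolean space* is a locally compact Hausdorff space whose clopen sets form a base. An *étale space* $(E,\pi,X)$ over $X$ consists of a space $E$ and a surjective local homeomorphism $\pi:E\to X$; $E_x=\pi^{-1}(x)$ is the stalk at $x$, and $E(U)$ is the set of (images of) continuous sections of $\pi$ over $U\subseteq X$. Let $(\mathcal A,g,X)$, $(\mathcal B,h,Y)$ be étale spaces and $f:X\to Y$ continuous. An *$f$-cohomomorphism* $k:\mathcal B\rightsquigarrow\mathcal A$ is a family of maps $k_x:\mathcal B_{f(x)}\to\mathcal A_x$ $(x\in X)$ such that for every open $U\subseteq Y$ and every section $s$ of $\mathcal B$ over $U$ the function $x\mapsto k_x(s(f(x)))$ is a section of $\mathcal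 A$ over $f^{-1}(U)$; it is *injective* if all $k_x$ are injective. A continuous map is *proper* if preimages of compact sets are compact. Let $\mathbf{LCBSh}$ be the category of étale spaces over locally compact Boolean spaces, a morphism from $(\mathcal B,h,Y)$ to $(\mathcal A,g,X)$ being a continuous proper map $f:X\to Y$ together with an $f$-cohomomorphism $\mathcal B\rightsquigarrow\mathcal A$. An étale space $(E,\pi,X)$ over a locally compact Boolean space has *compact clopen equalizers* if for all compact clopen $U,V\subseteq X$ and all $A\in E(U)$, $B\in E(V)$ there is a compact clopen $W\subseteq X$ with $A\cap B\in E(W)$. Let $\mathbf{ESLCBSE}$ be the category of étale spaces with compact clopen equalizers over locally compact Boolean spaces, with injective cohomomorphisms over continuous proper maps as morphisms. *The functor* $\mathbf{SB}:\mathbf{LCBSh}\to\mathbf{SkewB}$ sends $(E,\pi,X)$ to the set of all sections over compact clopen sets, where for $A\in E(U)$, $B\in E(V)$ the section $A\wedge B$ is $A$ restricted to $U\cap V$, the section $A\vee B$ over $U\cup V$ is $B$ on $V$ and $A$ on $U\setminus V$, the section $A\setminus B$ is $A$ restricted to $U\setminus V$, and $0=\varnothing$. It sends a cohomomorphism $k$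 over $f$ to the map taking $A\in\mathcal B(U)$ to the section $x\mapsto k_x(A(f(x)))$ over $f^{-1}(U)$. *The functor* $\mathbf{ES}:\mathbf{SkewB}\to\mathbf{LCBSh}$. For a generalized Boolean algebra $B$ let $B^\star$ be the set of its prime filters with the topology generated by the sets $\{F: b\in F\}$, $b\in B$. A filter of $S$ is a nonempty subset that is upward closed for $\le$ and closed under $\wedge$. A prime filter of $S$ over $F\in(S/\mathcal D)^\star$ is a minimal element of the set of filters $U$ of $S$ with $\alpha(U)=F$. Let $S^\star$ be the set of all prime filters of $S$, with the topology generated by the sets $\{U: a\in U\}$, $a\in S$. Then $\mathbf{ES}(S)=(S^\star,\pi,(S/\mathcal D)^\star)$, where $\pi(U)=F$ for $U$ over $F$. A proper homomorphism $k:T\to S$ is sent to the cohomomorphism over $F\mapsto\overline k^{-1}(F)$ whose component at $F\in(S/\mathcal D)^\star$ sends a prime filter $U$ of $T$ over $\overline k^{-1}(F)$ to the unique prime filter $V$ of $S$ over $F$ with $U\subseteq k^{-1}(V)$. **Theorem.** The functors $\mathbf{ES}$ and $\mathbf{SB}$ restrict to functors $\mathbf{LSBIA}\to\mathbf{ESLCBSE}$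 and $\mathbf{ESLCBSE}\to\mathbf{LSBIA}$, and these restrictions are mutually quasi-inverse equivalences of categories. In particular, the category $\mathbf{ESLCBSE}$ of étale spaces with compact clopen equalizers over locally compact Boolean spaces, with injective étale space cohomomorphisms over continuous proper maps, is equivalent to the category $\mathbf{LSBIA}$ of left-handed skew Boolean $\cap$-algebras with proper skew Boolean $\cap$-algebra homomorphisms. -/

import Mathlib

open CategoryTheory TopologicalSpace

universe u

namespace SkewStone

/-! ## Skew lattices and left-handed skew Boolean algebras -/

/-- A skew lattice: two associative idempotent operations satisfying the absorption laws.
The operations `⊓` (meet) and `⊔` (join) are in general not commutative. -/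
class SkewLattice (S : Type u) extends Min S, Max S where
  meet_assoc : ∀ x y z : S, x ⊓ y ⊓ z = x ⊓ (y ⊓ z)
  join_assoc : ∀ x y z : S, x ⊔ y ⊔ z = x ⊔ (y ⊔ z)
  meet_idem : ∀ x : S, x ⊓ x = x
  join_idem : ∀ x : S, x ⊔ x = x
  meet_join_self : ∀ x y : S, x ⊓ (x ⊔ y) = x
  join_meet_self : ∀ x y : S, x ⊔ (x ⊓ y) = x
  join_meet_right_self : ∀ x y : S, (y ⊔ x) ⊓ x = x
  meet_join_right_self : ∀ x y : S, (y ⊓ x) ⊔ x = x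

/-- The natural partial order of a skew lattice: `x ≤ y` iff `x ⊓ y = x` and `y ⊓ x = x`. -/
instance SkewLattice.instPartialOrder (S : Type u) [SkewLattice S] : PartialOrder S where
  le x y := x ⊓ y = x ∧ y ⊓ x = x
  le_refl x := ⟨SkewLattice.meet_idem x, SkewLattice.meet_idem x⟩
  le_trans x y z h₁ h₂ := by
    refine ⟨?_, ?_⟩
    · rw [← h₁.1, SkewLattice.meet_assoc, h₂.1]
    · rw [← h₁.2, ← SkewLattice.meet_assoc, h₂.2]
  le_antisymm x y h₁ h₂ := h₁.1.symm.trans h₂.2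

/-- A left-handed skew Boolean algebra `(S; ⊓, ⊔, \, ⊥)`: a left-handed symmetric skew lattice with
zero `⊥` in which every principal subalgebra `{u | u ≤ x}` is a Boolean lattice (with respect to
`⊓`, `⊔`, with bottom `⊥` and top `x`), and in which `a \ b` is the complement of `a ⊓ b ⊓ a` in
`{u | u ≤ a}`. -/
class SkewBooleanAlgebra (S : Type u) extends SkewLattice S, Bot S, SDiff S where
  left_handed_inf : ∀ x y : S, x ⊓ y ⊓ x = x ⊓ y
  left_handed_sup : ∀ x y : S, x ⊔ y ⊔ x = y ⊔ x
  symmetric : ∀ x y : S, x ⊔ y = y ⊔ x ↔ x ⊓ y = y ⊓ x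
  inf_bot : ∀ x : S, x ⊓ ⊥ = ⊥
  bot_inf : ∀ x : S, ⊥ ⊓ x = ⊥
  principal_inf_comm : ∀ x u v : S, u ≤ x → v ≤ x → u ⊓ v = v ⊓ u
  principal_sup_comm : ∀ x u v : S, u ≤ x → v ≤ x → u ⊔ v = v ⊔ u
  principal_inf_sup : ∀ x u v w : S, u ≤ x → v ≤ x → w ≤ x → u ⊓ (v ⊔ w) = (u ⊓ v) ⊔ (u ⊓ w)
  principal_compl : ∀ x u : S, u ≤ x → ∃ v ≤ x, u ⊓ v = ⊥ ∧ u ⊔ v = x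
  sdiff_le : ∀ a b : S, a \ b ≤ a
  inf_sdiff : ∀ a b : S, (a ⊓ b ⊓ a) ⊓ (a \ b) = ⊥
  sup_sdiff : ∀ a b : S, (a ⊓ b ⊓ a) ⊔ (a \ b) = a

section Algebra

variable {S : Type u} [SkewBooleanAlgebra S]

open SkewLattice SkewBooleanAlgebra

theorem le_iff {x y : S} : x ≤ y ↔ x ⊓ y = x ∧ y ⊓ x = x := Iff.rfl

theorem inf_eq_iff_sup_eq {x y : S} : x ⊓ y = x ↔ x ⊔ y = y := by
  constructor
  · intro h
    have := meet_join_right_self y x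
    rwa [h] at this
  · intro h
    have := meet_join_self x y
    rwa [h] at this

theorem inf_le_self (x y : S) : x ⊓ y ≤ x := by
  refine ⟨left_handed_inf x y, ?_⟩
  rw [← meet_assoc, meet_idem]

theorem inf_trans {x y z : S} (h₁ : x ⊓ y = x) (h₂ : y ⊓ z = y) : x ⊓ z = x := by
  rw [← h₁, meet_assoc, h₂]

theorem self_le_sup (x y : S) : y ≤ x ⊔ y := by
  refine ⟨?_, join_meet_right_self y x⟩
  rw [inf_eq_iff_sup_eq, ← join_assoc, left_handed_sup]

variable (S) in
/-- The relation `D`: `x D y` iff `x ⊓ y ⊓ x = x` and `y ⊓ x ⊓ y = y`. -/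
def dSetoid : Setoid S where
  r x y := x ⊓ y ⊓ x = x ∧ y ⊓ x ⊓ y = y
  iseqv := by
    refine ⟨fun x => by simp [meet_idem], fun h => ⟨h.2, h.1⟩, ?_⟩
    intro x y z h₁ h₂
    simp only [left_handed_inf] at *
    exact ⟨inf_trans h₁.1 h₂.1, inf_trans h₂.2 h₁.2⟩

theorem dSetoid_iff {x y : S} : (dSetoid S) x y ↔ x ⊓ y = x ∧ y ⊓ x = y := by
  change (x ⊓ y ⊓ x = x ∧ y ⊓ x ⊓ y = y) ↔ _
  simp only [left_handed_inf]

variable (S) in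
/-- The maximal lattice image `S / D`. -/
def MaxLat : Type u := Quotient (dSetoid S)

/-- The canonical projection `S → S / D`. -/
def proj (x : S) : MaxLat S := Quotient.mk (dSetoid S) x

theorem proj_surjective : Function.Surjective (proj : S → MaxLat S) := Quotient.mk_surjective

theorem proj_eq_iff {x y : S} : proj x = proj y ↔ x ⊓ y = x ∧ y ⊓ x = y := by
  rw [← dSetoid_iff]
  exact Quotient.eq

theorem inf_pre {x x' y y' : S} (hx : x ⊓ x' = x) (hy : y ⊓ y' = y) :
    (x ⊓ y) ⊓ (x' ⊓ y') = x ⊓ y := by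
  have h : x ⊓ y ⊓ x' = x ⊓ y := by
    conv_lhs => rw [← hx]
    rw [meet_assoc x, meet_assoc x, left_handed_inf, ← meet_assoc, hx]
  rw [← meet_assoc, h, meet_assoc, hy]

theorem sup_pre {x x' y y' : S} (hx : x ⊓ x' = x) (hy : y ⊓ y' = y) :
    (x ⊔ y) ⊓ (x' ⊔ y') = x ⊔ y := by
  rw [inf_eq_iff_sup_eq] at *
  have h : y ⊔ (x' ⊔ y') = x' ⊔ y' := by
    conv_lhs => rw [← hy]
    rw [← join_assoc x', ← join_assoc y, ← join_assoc y, left_handed_sup, join_assoc, hy]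
  rw [join_assoc, h, ← join_assoc, hx]

/-- The meet of `S / D`, induced by the meet of `S`. -/
def MaxLat.meet : MaxLat S → MaxLat S → MaxLat S :=
  Quotient.map₂ (fun x y => x ⊓ y) (by
    intro x x' hx y y' hy
    have hx := dSetoid_iff.1 hx
    have hy := dSetoid_iff.1 hy
    exact dSetoid_iff.2 ⟨inf_pre hx.1 hy.1, inf_pre hx.2 hy.2⟩)

/-- The join of `S / D`, induced by the join of `S`. -/
def MaxLat.join : MaxLat S → MaxLat S → MaxLat S :=
  Quotient.map₂ (fun x y => x ⊔ y) (by
    intro x x' hx y y' hy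
    have hx := dSetoid_iff.1 hx
    have hy := dSetoid_iff.1 hy
    exact dSetoid_iff.2 ⟨sup_pre hx.1 hy.1, sup_pre hx.2 hy.2⟩)

namespace MaxLat

theorem meet_comm (a b : MaxLat S) : meet a b = meet b a := by
  obtain ⟨x, rfl⟩ := proj_surjective a
  obtain ⟨y, rfl⟩ := proj_surjective b
  refine (proj_eq_iff (x := x ⊓ y) (y := y ⊓ x)).2 ⟨?_, ?_⟩
  · rw [← SkewLattice.meet_assoc, SkewLattice.meet_assoc x, SkewLattice.meet_idem, left_handed_inf]
  · rw [← SkewLattice.meet_assoc, SkewLattice.meet_assoc y, SkewLattice.meet_idem, left_handed_inf]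

theorem join_comm (a b : MaxLat S) : join a b = join b a := by
  obtain ⟨x, rfl⟩ := proj_surjective a
  obtain ⟨y, rfl⟩ := proj_surjective b
  refine (proj_eq_iff (x := x ⊔ y) (y := y ⊔ x)).2 ?_
  simp only [inf_eq_iff_sup_eq]
  constructor
  · rw [← SkewLattice.join_assoc, SkewLattice.join_assoc x, SkewLattice.join_idem, left_handed_sup]
  · rw [← SkewLattice.join_assoc, SkewLattice.join_assoc y, SkewLattice.join_idem, left_handed_sup]

theorem meet_assoc (a b c : MaxLat S) : meet (meet a b) c = meet a (meet b c) := by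
  obtain ⟨x, rfl⟩ := proj_surjective a
  obtain ⟨y, rfl⟩ := proj_surjective b
  obtain ⟨z, rfl⟩ := proj_surjective c
  exact congrArg proj (SkewLattice.meet_assoc x y z)

theorem join_assoc (a b c : MaxLat S) : join (join a b) c = join a (join b c) := by
  obtain ⟨x, rfl⟩ := proj_surjective a
  obtain ⟨y, rfl⟩ := proj_surjective b
  obtain ⟨z, rfl⟩ := proj_surjective c
  exact congrArg proj (SkewLattice.join_assoc x y z)

theorem meet_join_self (a b : MaxLat S) : meet a (join a b) = a := by
  obtain ⟨x, rfl⟩ := proj_surjective a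
  obtain ⟨y, rfl⟩ := proj_surjective b
  exact congrArg proj (SkewLattice.meet_join_self x y)

theorem meet_eq_iff (a b : MaxLat S) : meet a b = a ↔ join a b = b := by
  obtain ⟨x, rfl⟩ := proj_surjective a
  obtain ⟨y, rfl⟩ := proj_surjective b
  refine ⟨fun h => ?_, fun h => ?_⟩
  · rw [← h]
    exact congrArg proj (meet_join_right_self y x)
  · rw [← h]
    exact meet_join_self _ _

theorem meet_idem (a : MaxLat S) : meet a a = a := by
  obtain ⟨x, rfl⟩ := proj_surjective a
  exact congrArg proj (SkewLattice.meet_idem x)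

end MaxLat

/-- The lattice `S / D`, with `a ≤ b` iff `a ⊓ b = a`. -/
instance : Lattice (MaxLat S) where
  le a b := MaxLat.meet a b = a
  le_refl a := MaxLat.meet_idem a
  le_trans a b c h₁ h₂ := by
    change MaxLat.meet a b = a at h₁
    change MaxLat.meet b c = b at h₂
    rw [← h₁, MaxLat.meet_assoc, h₂]
  le_antisymm a b h₁ h₂ := by
    change MaxLat.meet a b = a at h₁
    change MaxLat.meet b a = b at h₂
    rw [← h₁, MaxLat.meet_comm, h₂]
  inf := MaxLat.meet
  sup := MaxLat.join
  inf_le_left a b := by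
    rw [MaxLat.meet_comm, ← MaxLat.meet_assoc, MaxLat.meet_idem]
  inf_le_right a b := by
    rw [MaxLat.meet_assoc, MaxLat.meet_idem]
  le_inf a b c h₁ h₂ := by
    change MaxLat.meet a b = a at h₁
    change MaxLat.meet a c = a at h₂
    rw [← MaxLat.meet_assoc, h₁, h₂]
  le_sup_left a b := MaxLat.meet_join_self a b
  le_sup_right a b := by
    rw [MaxLat.join_comm, MaxLat.meet_join_self]
  sup_le a b c h₁ h₂ := by
    change MaxLat.meet a c = a at h₁
    change MaxLat.meet b c = b at h₂
    rw [MaxLat.meet_eq_iff] at *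
    rw [MaxLat.join_assoc, h₂, h₁]

instance : Bot (MaxLat S) := ⟨proj ⊥⟩

theorem proj_inf (x y : S) : proj (x ⊓ y) = proj x ⊓ proj y := rfl

theorem proj_sup (x y : S) : proj (x ⊔ y) = proj x ⊔ proj y := rfl

theorem proj_bot : proj (⊥ : S) = ⊥ := rfl

theorem proj_le_iff {x y : S} : proj x ≤ proj y ↔ x ⊓ y = x := by
  rw [← inf_eq_left, ← proj_inf, proj_eq_iff]
  refine ⟨fun h => ?_, fun h => ?_⟩
  · have := h.2
    rwa [← meet_assoc, meet_idem] at this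
  · rw [h]
    exact ⟨meet_idem x, meet_idem x⟩

theorem proj_mono {x y : S} (h : x ≤ y) : proj x ≤ proj y := proj_le_iff.2 h.1

/-- Two elements of a principal subalgebra with the same image in `S / D` are equal. -/
theorem eq_of_le_of_proj_eq {x y c : S} (hx : x ≤ c) (hy : y ≤ c) (h : proj x = proj y) :
    x = y := by
  rw [proj_eq_iff] at h
  rw [← h.1, principal_inf_comm c x y hx hy, h.2]

/-- Below `proj c`, every element of `S / D` has a representative below `c`. -/
theorem exists_rep {c : S} {a : MaxLat S} (h : a ≤ proj c) : ∃ x ≤ c, proj x = a := by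
  obtain ⟨x, rfl⟩ := proj_surjective a
  exact ⟨c ⊓ x, inf_le_self c x, by rw [proj_inf, inf_eq_right.2 h]⟩

instance : DistribLattice (MaxLat S) :=
  DistribLattice.ofInfSupLe (by
    intro a b c
    obtain ⟨m, hm⟩ := proj_surjective (a ⊔ b ⊔ c)
    obtain ⟨x, hx, rfl⟩ := exists_rep (c := m) (a := a) (by rw [hm]; exact le_sup_left.trans le_sup_left)
    obtain ⟨y, hy, rfl⟩ := exists_rep (c := m) (a := b)
      (by rw [hm]; exact le_sup_right.trans le_sup_left)
    obtain ⟨z, hz, rfl⟩ := exists_rep (c := m) (a := c) (by rw [hm]; exact le_sup_right)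
    exact (congrArg proj (principal_inf_sup m x y z hx hy hz)).le)

theorem proj_inf_sdiff (x y : S) : proj x ⊓ proj y ⊓ proj (x \ y) = ⊥ := by
  have h := congrArg proj (inf_sdiff x y)
  rwa [left_handed_inf, proj_inf, proj_inf] at h

theorem proj_sup_sdiff (x y : S) : proj x ⊓ proj y ⊔ proj (x \ y) = proj x := by
  have h := congrArg proj (sup_sdiff x y)
  rwa [left_handed_inf, proj_sup, proj_inf] at h

instance : SDiff (MaxLat S) :=
  ⟨Quotient.map₂ (fun x y => x \ y) (by
    intro x x' hx y y' hy
    have hx' : proj x = proj x' := Quotient.sound hx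
    have hy' : proj y = proj y' := Quotient.sound hy
    refine Quotient.exact (s := dSetoid S) (?_ : proj (x \ y) = proj (x' \ y'))
    refine eq_of_inf_eq_sup_eq (a := proj x ⊓ proj y) ?_ ?_
    · rw [inf_comm, proj_inf_sdiff, hx', hy', inf_comm, proj_inf_sdiff]
    · rw [sup_comm, proj_sup_sdiff, hx', hy', sup_comm, proj_sup_sdiff])⟩

theorem proj_sdiff (x y : S) : proj (x \ y) = proj x \ proj y := rfl

/-- `S / D` is a generalized Boolean algebra. -/
instance : GeneralizedBooleanAlgebra (MaxLat S) where
  sup_inf_sdiff a b := by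
    obtain ⟨x, rfl⟩ := proj_surjective a
    obtain ⟨y, rfl⟩ := proj_surjective b
    exact proj_sup_sdiff x y
  inf_inf_sdiff a b := by
    obtain ⟨x, rfl⟩ := proj_surjective a
    obtain ⟨y, rfl⟩ := proj_surjective b
    exact proj_inf_sdiff x y

end Algebra

/-! ## Homomorphisms of skew Boolean algebras -/

/-- A homomorphism of skew Boolean algebras. -/
@[ext]
structure SBAHom (S T : Type u) [SkewBooleanAlgebra S] [SkewBooleanAlgebra T] where
  toFun : S → T
  map_inf : ∀ a b, toFun (a ⊓ b) = toFun a ⊓ toFun b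
  map_sup : ∀ a b, toFun (a ⊔ b) = toFun a ⊔ toFun b
  map_sdiff : ∀ a b, toFun (a \ b) = toFun a \ toFun b
  map_bot : toFun ⊥ = ⊥

namespace SBAHom

variable {S T R : Type u} [SkewBooleanAlgebra S] [SkewBooleanAlgebra T] [SkewBooleanAlgebra R]

theorem map_le (k : SBAHom S T) {a b : S} (h : a ≤ b) : k.toFun a ≤ k.toFun b :=
  ⟨by rw [← k.map_inf, h.1], by rw [← k.map_inf, h.2]⟩

/-- The induced map `S / D → T / D`. -/
def induced (k : SBAHom S T) : MaxLat S → MaxLat T :=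
  Quotient.map k.toFun (by
    intro x y h
    have h := dSetoid_iff.1 h
    exact dSetoid_iff.2 ⟨by rw [← k.map_inf, h.1], by rw [← k.map_inf, h.2]⟩)

theorem induced_proj (k : SBAHom S T) (x : S) : k.induced (proj x) = proj (k.toFun x) := rfl

/-- A homomorphism is proper if the induced homomorphism of generalized Boolean algebras is
proper: every element of `T / D` lies below some value of it. -/
def IsProper (k : SBAHom S T) : Prop := ∀ c : MaxLat T, ∃ b : MaxLat S, c ≤ k.induced b

/-- The identity homomorphism. -/
def id (S : Type u) [SkewBooleanAlgebra S] : SBAHom S S where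
  toFun x := x
  map_inf _ _ := rfl
  map_sup _ _ := rfl
  map_sdiff _ _ := rfl
  map_bot := rfl

/-- Composition of homomorphisms, first `k`, then `l`. -/
def comp (k : SBAHom S T) (l : SBAHom T R) : SBAHom S R where
  toFun x := l.toFun (k.toFun x)
  map_inf a b := by rw [k.map_inf, l.map_inf]
  map_sup a b := by rw [k.map_sup, l.map_sup]
  map_sdiff a b := by rw [k.map_sdiff, l.map_sdiff]
  map_bot := by rw [k.map_bot, l.map_bot]

theorem isProper_id : (SBAHom.id S).IsProper := fun c => by
  obtain ⟨x, rfl⟩ := proj_surjective c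
  exact ⟨proj x, le_rfl⟩

theorem induced_inf (k : SBAHom S T) (a b : MaxLat S) :
    k.induced (a ⊓ b) = k.induced a ⊓ k.induced b := by
  obtain ⟨x, rfl⟩ := proj_surjective a
  obtain ⟨y, rfl⟩ := proj_surjective b
  exact congrArg proj (k.map_inf x y)

theorem induced_sup (k : SBAHom S T) (a b : MaxLat S) :
    k.induced (a ⊔ b) = k.induced a ⊔ k.induced b := by
  obtain ⟨x, rfl⟩ := proj_surjective a
  obtain ⟨y, rfl⟩ := proj_surjective b
  exact congrArg proj (k.map_sup x y)

theorem induced_bot (k : SBAHom S T) : k.induced ⊥ = ⊥ := congrArg proj k.map_bot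

theorem induced_mono (k : SBAHom S T) {a b : MaxLat S} (h : a ≤ b) :
    k.induced a ≤ k.induced b := by
  rw [← inf_eq_left] at h ⊢
  rw [← induced_inf, h]

theorem IsProper.comp {k : SBAHom S T} {l : SBAHom T R} (hk : k.IsProper) (hl : l.IsProper) :
    (k.comp l).IsProper := fun c => by
  obtain ⟨b, hb⟩ := hl c
  obtain ⟨a, ha⟩ := hk b
  obtain ⟨x, rfl⟩ := proj_surjective a
  exact ⟨proj x, hb.trans (l.induced_mono ha)⟩

end SBAHom

/-- The objects of the category of left-handed skew Boolean algebras. -/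
structure SkewB : Type (u + 1) where
  carrier : Type u
  [str : SkewBooleanAlgebra carrier]

attribute [instance] SkewB.str

/-- Morphisms: proper homomorphisms of skew Boolean algebras. -/
@[ext]
structure SkewB.Hom (S T : SkewB.{u}) where
  hom : SBAHom S.carrier T.carrier
  proper : hom.IsProper

instance : Category SkewB.{u} where
  Hom := SkewB.Hom
  id S := ⟨SBAHom.id S.carrier, SBAHom.isProper_id⟩
  comp k l := ⟨k.hom.comp l.hom, k.proper.comp l.proper⟩

/-! ## Skew Boolean ∩-algebras -/

/-- `S` has finite intersections: every nonempty finite set of elements has a greatest lower bound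
with respect to the natural partial order. -/
def HasFiniteIntersections (S : Type u) [SkewBooleanAlgebra S] : Prop :=
  ∀ s : Set S, s.Finite → s.Nonempty → ∃ c : S, IsGLB s c

/-- The objects of the category of left-handed skew Boolean ∩-algebras. -/
structure LSBIA : Type (u + 1) where
  toSkewB : SkewB.{u}
  hasInter : HasFiniteIntersections toSkewB.carrier

/-- The operation `∩`: the greatest lower bound of two elements. -/
noncomputable def LSBIA.inter (S : LSBIA.{u}) (a b : S.toSkewB.carrier) : S.toSkewB.carrier :=
  (S.hasInter {a, b} (Set.toFinite _) ⟨a, Set.mem_insert a _⟩).choose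

theorem LSBIA.isGLB_inter (S : LSBIA.{u}) (a b : S.toSkewB.carrier) :
    IsGLB {a, b} (S.inter a b) :=
  (S.hasInter {a, b} (Set.toFinite _) ⟨a, Set.mem_insert a _⟩).choose_spec

/-- Morphisms: proper homomorphisms of skew Boolean algebras that preserve `∩`. -/
@[ext]
structure LSBIA.Hom (S T : LSBIA.{u}) where
  hom : S.toSkewB ⟶ T.toSkewB
  map_inter : ∀ a b, hom.hom.toFun (S.inter a b) = T.inter (hom.hom.toFun a) (hom.hom.toFun b)

instance : Category LSBIA.{u} where
  Hom := LSBIA.Hom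
  id S := ⟨𝟙 S.toSkewB, fun _ _ => rfl⟩
  comp {_ _ R} k l := ⟨k.hom ≫ l.hom, fun a b =>
    (congrArg l.hom.hom.toFun (k.map_inter a b)).trans (l.map_inter _ _)⟩

/-- The inclusion of left-handed skew Boolean ∩-algebras into left-handed skew Boolean algebras. -/
def LSBIA.incl : LSBIA.{u} ⥤ SkewB.{u} where
  obj S := S.toSkewB
  map k := k.hom

/-! ## Locally compact Boolean spaces and étale spaces -/

/-- A locally compact Boolean space: a locally compact Hausdorff space in which the clopen sets
form a base. -/
structure IsLCBSpace (X : Type u) [TopologicalSpace X] : Prop where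
  t2 : T2Space X
  locallyCompact : ∀ x : X, ∃ K : Set X, IsCompact K ∧ x ∈ interior K
  clopenBasis : IsTopologicalBasis {U : Set X | IsClopen U}

theorem IsLCBSpace.exists_compact_clopen {X : Type u} [TopologicalSpace X] (h : IsLCBSpace X)
    {x : X} {O : Set X} (hO : IsOpen O) (hx : x ∈ O) :
    ∃ W : Set X, IsCompact W ∧ IsClopen W ∧ x ∈ W ∧ W ⊆ O := by
  obtain ⟨K, hK, hxK⟩ := h.locallyCompact x
  obtain ⟨W, hW, hxW, hWO⟩ := h.clopenBasis.exists_subset_of_mem_open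
    (show x ∈ O ∩ interior K from ⟨hx, hxK⟩) (hO.inter isOpen_interior)
  exact ⟨W, hK.of_isClosed_subset hW.isClosed
    ((hWO.trans Set.inter_subset_right).trans interior_subset), hW, hxW,
    hWO.trans Set.inter_subset_left⟩

/-- An étale space `(E, π, X)` over a locally compact Boolean space `X`: the covering map
`π : E → X` is a surjective local homeomorphism. -/
structure LCBSh : Type (u + 1) where
  X : Type u
  E : Type u
  [topX : TopologicalSpace X]
  [topE : TopologicalSpace E]
  isLCB : IsLCBSpace X
  π : E → X
  isLocalHomeomorph : IsLocalHomeomorph π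
  surjective : Function.Surjective π

attribute [instance] LCBSh.topX LCBSh.topE

/-- `s` is a (continuous) section of `π` over `U`. -/
structure LCBSh.IsSection (𝓔 : LCBSh.{u}) (U : Set 𝓔.X) (s : U → 𝓔.E) : Prop where
  continuous : Continuous s
  π_apply : ∀ x : U, 𝓔.π (s x) = x

/-- For `f : X → Y` and étale spaces `𝓐` over `X` and `𝓑` over `Y`, an `f`-cohomomorphism
`𝓑 ⇝ 𝓐`: a family of maps `k x` from the stalk of `𝓑` at `f x` to the stalk of `𝓐` at `x`, such
that for every section `s` of `𝓑` over an open set `U` the function `x ↦ k x (s (f x))` is a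
section of `𝓐` over `f ⁻¹ U`. -/
@[ext]
structure Cohom (𝓑 𝓐 : LCBSh.{u}) (f : 𝓐.X → 𝓑.X) where
  map : ∀ (x : 𝓐.X) (b : 𝓑.E), 𝓑.π b = f x → 𝓐.E
  π_map : ∀ (x : 𝓐.X) (b : 𝓑.E) (h : 𝓑.π b = f x), 𝓐.π (map x b h) = x
  isSection_map : ∀ (U : Set 𝓑.X), IsOpen U → ∀ (s : U → 𝓑.E) (hs : 𝓑.IsSection U s),
    𝓐.IsSection (f ⁻¹' U) (fun x => map x (s ⟨f x, x.2⟩) (hs.π_apply ⟨f x, x.2⟩))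

/-- A cohomomorphism is injective if all its stalk maps are injective. -/
def Cohom.IsInjective {𝓑 𝓐 : LCBSh.{u}} {f : 𝓐.X → 𝓑.X} (k : Cohom 𝓑 𝓐 f) : Prop :=
  ∀ (x : 𝓐.X) (b b' : 𝓑.E) (h : 𝓑.π b = f x) (h' : 𝓑.π b' = f x),
    k.map x b h = k.map x b' h' → b = b'

/-- The morphisms from `𝓑` (over `Y`) to `𝓐` (over `X`): a continuous proper map `X → Y` together
with a cohomomorphism `𝓑 ⇝ 𝓐` over it. A continuous map is proper if preimages of compact sets are
compact. -/
structure LCBSh.Hom (𝓑 𝓐 : LCBSh.{u}) where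
  base : 𝓐.X → 𝓑.X
  base_continuous : Continuous base
  base_proper : ∀ K : Set 𝓑.X, IsCompact K → IsCompact (base ⁻¹' K)
  cohom : Cohom 𝓑 𝓐 base

theorem LCBSh.Hom.ext' {𝓑 𝓐 : LCBSh.{u}} {k l : LCBSh.Hom 𝓑 𝓐}
    (h₁ : ∀ x, k.base x = l.base x)
    (h₂ : ∀ x b h h', k.cohom.map x b h = l.cohom.map x b h') : k = l := by
  obtain ⟨f, hf, hf', k, hk, hk'⟩ := k
  obtain ⟨g, hg, hg', l, hl, hl'⟩ := l
  obtain rfl : f = g := funext h₁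
  obtain rfl : k = l := by
    funext x b h
    exact h₂ x b h h
  rfl

/-- The identity cohomomorphism. -/
def LCBSh.Hom.id (𝓐 : LCBSh.{u}) : LCBSh.Hom 𝓐 𝓐 where
  base x := x
  base_continuous := continuous_id
  base_proper _ hK := hK
  cohom :=
    { map := fun _ b _ => b
      π_map := fun _ _ h => h
      isSection_map := fun _ _ _ hs => hs }

/-- The composite `𝓒 ⇝ 𝓑 ⇝ 𝓐`, stalkwise the composition of maps. -/
def LCBSh.Hom.comp {𝓒 𝓑 𝓐 : LCBSh.{u}} (k : LCBSh.Hom 𝓒 𝓑) (l : LCBSh.Hom 𝓑 𝓐) :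
    LCBSh.Hom 𝓒 𝓐 where
  base x := k.base (l.base x)
  base_continuous := k.base_continuous.comp l.base_continuous
  base_proper K hK := l.base_proper _ (k.base_proper K hK)
  cohom :=
    { map := fun x c h => l.cohom.map x (k.cohom.map (l.base x) c h) (k.cohom.π_map _ _ _)
      π_map := fun _ _ _ => l.cohom.π_map _ _ _
      isSection_map := fun U hU s hs =>
        l.cohom.isSection_map _ (hU.preimage k.base_continuous) _ (k.cohom.isSection_map U hU s hs) }

/-- The category of étale spaces over locally compact Boolean spaces, with cohomomorphisms over
continuous proper maps as morphisms. -/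
instance : Category LCBSh.{u} where
  Hom := LCBSh.Hom
  id := LCBSh.Hom.id
  comp := LCBSh.Hom.comp

/-- `A` is (the image of) a section over `U`, i.e. `A ∈ E(U)`. -/
def LCBSh.IsSectionSet (𝓔 : LCBSh.{u}) (U : Set 𝓔.X) (A : Set 𝓔.E) : Prop :=
  ∃ s : U → 𝓔.E, 𝓔.IsSection U s ∧ Set.range s = A

/-- The étale space has compact clopen equalizers: for sections `A ∈ E(U)` and `B ∈ E(V)` over
compact clopen sets, `A ∩ B` is a section over some compact clopen set. -/
def LCBSh.HasCompactClopenEqualizers (𝓔 : LCBSh.{u}) : Prop :=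
  ∀ U V : Set 𝓔.X, IsCompact U → IsClopen U → IsCompact V → IsClopen V →
    ∀ A B : Set 𝓔.E, 𝓔.IsSectionSet U A → 𝓔.IsSectionSet V B →
      ∃ W : Set 𝓔.X, IsCompact W ∧ IsClopen W ∧ 𝓔.IsSectionSet W (A ∩ B)

/-- The objects of the category of étale spaces with compact clopen equalizers over locally compact
Boolean spaces. -/
structure ESLCBSE : Type (u + 1) where
  toLCBSh : LCBSh.{u}
  equalizers : toLCBSh.HasCompactClopenEqualizers

/-- Morphisms: injective cohomomorphisms over continuous proper maps. -/
@[ext]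
structure ESLCBSE.Hom (𝓑 𝓐 : ESLCBSE.{u}) where
  hom : 𝓑.toLCBSh ⟶ 𝓐.toLCBSh
  injective : hom.cohom.IsInjective

instance : Category ESLCBSE.{u} where
  Hom := ESLCBSE.Hom
  id 𝓐 := ⟨𝟙 𝓐.toLCBSh, fun _ _ _ _ _ h => h⟩
  comp k l := ⟨k.hom ≫ l.hom, fun x b b' h h' e =>
    k.injective _ b b' h h' (l.injective x _ _ (k.hom.cohom.π_map _ _ _)
      (k.hom.cohom.π_map _ _ _) e)⟩

/-- The inclusion into étale spaces over locally compact Boolean spaces. -/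
def ESLCBSE.incl : ESLCBSE.{u} ⥤ LCBSh.{u} where
  obj 𝓔 := 𝓔.toLCBSh
  map k := k.hom

/-! ## The dual skew Boolean algebra of an étale space -/

/-- The compact clopen sections of `𝓔`: the sections over compact clopen sets. These are the
elements of the dual skew Boolean algebra of `𝓔`. -/
@[ext]
structure CSec (𝓔 : LCBSh.{u}) : Type u where
  carrier : Set 𝓔.E
  isSection : ∃ U : Set 𝓔.X, IsCompact U ∧ IsClopen U ∧ 𝓔.IsSectionSet U carrier

section Sections

variable {𝓔 : LCBSh.{u}}

theorem LCBSh.IsSectionSet.image {U : Set 𝓔.X} {A : Set 𝓔.E} (h : 𝓔.IsSectionSet U A) :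
    𝓔.π '' A = U := by
  obtain ⟨s, hs, rfl⟩ := h
  ext x
  constructor
  · rintro ⟨_, ⟨y, rfl⟩, rfl⟩
    rw [hs.π_apply]
    exact y.2
  · intro hx
    exact ⟨_, ⟨⟨x, hx⟩, rfl⟩, hs.π_apply _⟩

theorem LCBSh.IsSectionSet.injOn {U : Set 𝓔.X} {A : Set 𝓔.E} (h : 𝓔.IsSectionSet U A) :
    Set.InjOn 𝓔.π A := by
  obtain ⟨s, hs, rfl⟩ := h
  rintro _ ⟨x, rfl⟩ _ ⟨y, rfl⟩ hxy
  rw [hs.π_apply, hs.π_apply] at hxy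
  rw [Subtype.ext hxy]

theorem LCBSh.IsSectionSet.isOpen {U : Set 𝓔.X} {A : Set 𝓔.E} (h : 𝓔.IsSectionSet U A)
    (hU : IsOpen U) : IsOpen A := by
  obtain ⟨s, hs, rfl⟩ := h
  refine (𝓔.isLocalHomeomorph.isOpenEmbedding_of_comp ?_ hs.continuous).isOpen_range
  have : 𝓔.π ∘ s = Subtype.val := funext hs.π_apply
  rw [this]
  exact hU.isOpenEmbedding_subtypeVal

theorem LCBSh.IsSectionSet.isCompact {U : Set 𝓔.X} {A : Set 𝓔.E} (h : 𝓔.IsSectionSet U A)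
    (hU : IsCompact U) : IsCompact A := by
  obtain ⟨s, hs, rfl⟩ := h
  have := isCompact_iff_compactSpace.1 hU
  exact isCompact_range hs.continuous

/-- A subset of `E` is a section over a compact clopen set if and only if it is compact and open
and `π` is injective on it. -/
theorem csec_iff {A : Set 𝓔.E} :
    (∃ U : Set 𝓔.X, IsCompact U ∧ IsClopen U ∧ 𝓔.IsSectionSet U A) ↔
      IsOpen A ∧ IsCompact A ∧ Set.InjOn 𝓔.π A := by
  constructor
  · rintro ⟨U, hU, hU', hA⟩
    exact ⟨hA.isOpen hU'.isOpen, hA.isCompact hU, hA.injOn⟩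
  · rintro ⟨h₁, h₂, h₃⟩
    have := 𝓔.isLCB.t2
    have hc : IsCompact (𝓔.π '' A) := h₂.image 𝓔.isLocalHomeomorph.continuous
    refine ⟨𝓔.π '' A, hc, ⟨hc.isClosed, 𝓔.isLocalHomeomorph.isOpenMap _ h₁⟩, ?_⟩
    let e : A ≃ 𝓔.π '' A := Equiv.Set.imageOfInjOn 𝓔.π A h₃
    have he : ∀ a : A, ((e a : 𝓔.π '' A) : 𝓔.X) = 𝓔.π a := fun a => rfl
    have hopen : IsOpenMap e := by
      intro O hO
      rw [isOpen_induced_iff]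
      obtain ⟨O', hO', rfl⟩ := isOpen_induced_iff.1 hO
      refine ⟨𝓔.π '' (O' ∩ A), 𝓔.isLocalHomeomorph.isOpenMap _ (hO'.inter h₁), ?_⟩
      ext ⟨x, hx⟩
      constructor
      · rintro ⟨a, ⟨ha, ha'⟩, rfl⟩
        exact ⟨⟨a, ha'⟩, ha, rfl⟩
      · rintro ⟨⟨a, ha'⟩, ha, h⟩
        exact ⟨a, ⟨ha, ha'⟩, congrArg Subtype.val h⟩
    refine ⟨fun x => (e.symm x : 𝓔.E), ⟨?_, ?_⟩, ?_⟩
    · refine continuous_subtype_val.comp ?_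
      rw [continuous_def]
      intro O hO
      rw [← e.image_eq_preimage_symm]
      exact hopen O hO
    · intro x
      rw [← he, e.apply_symm_apply]
    · ext a
      constructor
      · rintro ⟨x, rfl⟩
        exact (e.symm x).2
      · intro ha
        exact ⟨e ⟨a, ha⟩, by simp⟩

namespace CSec

theorem isOpen (A : CSec 𝓔) : IsOpen A.carrier := (csec_iff.1 A.isSection).1

theorem isCompact (A : CSec 𝓔) : IsCompact A.carrier := (csec_iff.1 A.isSection).2.1

theorem injOn (A : CSec 𝓔) : Set.InjOn 𝓔.π A.carrier := (csec_iff.1 A.isSection).2.2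

/-- The set over which `A` is a section. -/
def dom (A : CSec 𝓔) : Set 𝓔.X := 𝓔.π '' A.carrier

theorem dom_spec (A : CSec 𝓔) :
    IsCompact A.dom ∧ IsClopen A.dom ∧ 𝓔.IsSectionSet A.dom A.carrier := by
  obtain ⟨U, h₁, h₂, h₃⟩ := A.isSection
  have : A.dom = U := h₃.image
  rw [this]
  exact ⟨h₁, h₂, h₃⟩

theorem isClopen_preimage (A : CSec 𝓔) : IsClopen (𝓔.π ⁻¹' A.dom) :=
  A.dom_spec.2.1.preimage 𝓔.isLocalHomeomorph.continuous

/-- Quasi-intersection: for `A` over `U` and `B` over `V`, the section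
`(A ⊓ B)(x) = A(x)` over `U ∩ V`. -/
instance : Min (CSec 𝓔) :=
  ⟨fun A B => ⟨A.carrier ∩ 𝓔.π ⁻¹' B.dom, csec_iff.2
    ⟨A.isOpen.inter B.isClopen_preimage.isOpen, A.isCompact.inter_right
      B.isClopen_preimage.isClosed, A.injOn.mono Set.inter_subset_left⟩⟩⟩

/-- Quasi-union: for `A` over `U` and `B` over `V`, the section over `U ∪ V` with
`(A ⊔ B)(x) = B(x)` for `x ∈ V` and `(A ⊔ B)(x) = A(x)` for `x ∈ U \ V`. -/
instance : Max (CSec 𝓔) :=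
  ⟨fun A B => ⟨B.carrier ∪ (A.carrier \ 𝓔.π ⁻¹' B.dom), csec_iff.2
    ⟨B.isOpen.union (A.isOpen.sdiff B.isClopen_preimage.isClosed),
      B.isCompact.union (A.isCompact.diff B.isClopen_preimage.isOpen), by
        rintro a (ha | ha) b (hb | hb) hab
        · exact B.injOn ha hb hab
        · exact (hb.2 ⟨a, ha, hab⟩).elim
        · exact (ha.2 ⟨b, hb, hab.symm⟩).elim
        · exact A.injOn ha.1 hb.1 hab⟩⟩⟩

/-- Quasi-complement: for `A` over `U` and `B` over `V`, the section
`(A \ B)(x) = A(x)` over `U \ V`. -/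
instance : SDiff (CSec 𝓔) :=
  ⟨fun A B => ⟨A.carrier \ 𝓔.π ⁻¹' B.dom, csec_iff.2
    ⟨A.isOpen.sdiff B.isClopen_preimage.isClosed, A.isCompact.diff B.isClopen_preimage.isOpen,
      A.injOn.mono Set.sdiff_subset⟩⟩⟩

/-- The section over the empty set. -/
instance : Bot (CSec 𝓔) :=
  ⟨⟨∅, csec_iff.2 ⟨isOpen_empty, isCompact_empty, Set.injOn_empty _⟩⟩⟩

theorem mem_inf {A B : CSec 𝓔} {e : 𝓔.E} :
    e ∈ (A ⊓ B).carrier ↔ e ∈ A.carrier ∧ 𝓔.π e ∈ B.dom := Iff.rfl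

theorem mem_sup {A B : CSec 𝓔} {e : 𝓔.E} :
    e ∈ (A ⊔ B).carrier ↔ e ∈ B.carrier ∨ (e ∈ A.carrier ∧ 𝓔.π e ∉ B.dom) := Iff.rfl

theorem mem_sdiff {A B : CSec 𝓔} {e : 𝓔.E} :
    e ∈ (A \ B).carrier ↔ e ∈ A.carrier ∧ 𝓔.π e ∉ B.dom := Iff.rfl

theorem not_mem_bot {e : 𝓔.E} : e ∉ (⊥ : CSec 𝓔).carrier := fun h => h

theorem mem_dom {A : CSec 𝓔} {e : 𝓔.E} (h : e ∈ A.carrier) : 𝓔.π e ∈ A.dom := ⟨e, h, rfl⟩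

theorem mem_dom_inf {A B : CSec 𝓔} {x : 𝓔.X} : x ∈ (A ⊓ B).dom ↔ x ∈ A.dom ∧ x ∈ B.dom := by
  constructor
  · rintro ⟨e, ⟨h₁, h₂⟩, rfl⟩
    exact ⟨mem_dom h₁, h₂⟩
  · rintro ⟨⟨e, h, rfl⟩, h₂⟩
    exact ⟨e, ⟨h, h₂⟩, rfl⟩

theorem mem_dom_sup {A B : CSec 𝓔} {x : 𝓔.X} : x ∈ (A ⊔ B).dom ↔ x ∈ A.dom ∨ x ∈ B.dom := by
  constructor
  · rintro ⟨e, h', rfl⟩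
    rcases mem_sup.1 h' with h | h
    · exact Or.inr (mem_dom h)
    · exact Or.inl (mem_dom h.1)
  · intro h
    by_cases hB : x ∈ B.dom
    · obtain ⟨e, h', rfl⟩ := hB
      exact ⟨e, mem_sup.2 (Or.inl h'), rfl⟩
    · obtain ⟨e, h', rfl⟩ := h.resolve_right hB
      exact ⟨e, mem_sup.2 (Or.inr ⟨h', hB⟩), rfl⟩

theorem mem_dom_sdiff {A B : CSec 𝓔} {x : 𝓔.X} : x ∈ (A \ B).dom ↔ x ∈ A.dom ∧ x ∉ B.dom := by
  constructor
  · rintro ⟨e, ⟨h₁, h₂⟩, rfl⟩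
    exact ⟨mem_dom h₁, h₂⟩
  · rintro ⟨⟨e, h, rfl⟩, h₂⟩
    exact ⟨e, ⟨h, h₂⟩, rfl⟩

theorem ext_iff' {A B : CSec 𝓔} : A = B ↔ ∀ e, e ∈ A.carrier ↔ e ∈ B.carrier := by
  rw [CSec.ext_iff, Set.ext_iff]

instance : SkewLattice (CSec 𝓔) where
  meet_assoc A B C := ext_iff'.2 fun e => by
    simp only [mem_inf, mem_dom_inf]; tauto
  join_assoc A B C := ext_iff'.2 fun e => by
    simp only [mem_sup, mem_dom_sup]; tauto
  meet_idem A := ext_iff'.2 fun e => by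
    simp only [mem_inf]; exact ⟨fun h => h.1, fun h => ⟨h, mem_dom h⟩⟩
  join_idem A := ext_iff'.2 fun e => by
    simp only [mem_sup]
    exact ⟨fun h => h.elim (fun h => h) fun h => h.1, Or.inl⟩
  meet_join_self A B := ext_iff'.2 fun e => by
    have := @mem_dom _ A e
    simp only [mem_inf, mem_dom_sup]; tauto
  join_meet_self A B := ext_iff'.2 fun e => by
    simp only [mem_inf, mem_sup, mem_dom_inf]
    have := @mem_dom _ A e
    tauto
  join_meet_right_self A B := ext_iff'.2 fun e => by
    simp only [mem_inf, mem_sup]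
    have := @mem_dom _ A e
    tauto
  meet_join_right_self A B := ext_iff'.2 fun e => by
    simp only [mem_inf, mem_sup]
    have := @mem_dom _ A e
    tauto

/-- The natural partial order is inclusion of sections. -/
theorem le_iff_subset {A B : CSec 𝓔} : A ≤ B ↔ A.carrier ⊆ B.carrier := by
  change (A ⊓ B = A ∧ B ⊓ A = A) ↔ _
  rw [ext_iff', ext_iff']
  simp only [mem_inf]
  constructor
  · rintro ⟨-, h⟩ e he
    exact ((h e).2 he).1
  · intro h
    refine ⟨fun e => ⟨fun h' => h'.1, fun he => ⟨he, mem_dom (h he)⟩⟩, fun e => ?_⟩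
    constructor
    · rintro ⟨h₁, a, ha, hae⟩
      rwa [← B.injOn (h ha) h₁ hae]
    · intro he
      exact ⟨h he, mem_dom he⟩

/-- Below `C`, a section is determined by its domain. -/
theorem mem_iff_of_le {A C : CSec 𝓔} (h : A ≤ C) {e : 𝓔.E} :
    e ∈ A.carrier ↔ e ∈ C.carrier ∧ 𝓔.π e ∈ A.dom := by
  constructor
  · intro he
    exact ⟨le_iff_subset.1 h he, mem_dom he⟩
  · rintro ⟨h₁, a, ha, hae⟩
    rwa [← C.injOn (le_iff_subset.1 h ha) h₁ hae]

theorem symm_iff {A B : CSec 𝓔} :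
    (A ⊔ B = B ⊔ A ↔ A ⊓ B = B ⊓ A) := by
  simp only [ext_iff', mem_inf, mem_sup]
  constructor
  · intro h e
    have := h e
    have := @mem_dom _ A e
    have := @mem_dom _ B e
    tauto
  · intro h e
    have := h e
    have := @mem_dom _ A e
    have := @mem_dom _ B e
    tauto

/-- The dual skew Boolean algebra of an étale space. -/
instance : SkewBooleanAlgebra (CSec 𝓔) where
  left_handed_inf A B := ext_iff'.2 fun e => by
    have := @mem_dom _ A e
    simp only [mem_inf]; tauto
  left_handed_sup A B := ext_iff'.2 fun e => by
    have := @mem_dom _ A e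
    simp only [mem_sup]; tauto
  symmetric _ _ := symm_iff
  inf_bot A := ext_iff'.2 fun e => by
    simp only [mem_inf]
    exact ⟨fun ⟨_, a, ha, _⟩ => (not_mem_bot ha).elim, fun h => (not_mem_bot h).elim⟩
  bot_inf A := ext_iff'.2 fun e => by
    simp only [mem_inf, not_mem_bot, false_and]
  principal_inf_comm C A B hA hB := ext_iff'.2 fun e => by
    simp only [mem_inf, mem_iff_of_le hA, mem_iff_of_le hB]; tauto
  principal_sup_comm C A B hA hB := ext_iff'.2 fun e => by
    simp only [mem_sup, mem_iff_of_le hA, mem_iff_of_le hB]; tauto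
  principal_inf_sup X A B C hA hB hC := ext_iff'.2 fun e => by
    simp only [mem_inf, mem_sup, mem_dom_sup, mem_dom_inf]; tauto
  principal_compl C A hA := by
    refine ⟨C \ A, le_iff_subset.2 fun e he => he.1, ext_iff'.2 fun e => ?_, ext_iff'.2 fun e => ?_⟩
    · simp only [mem_inf, mem_dom_sdiff, not_mem_bot]
      have := @mem_dom _ A e
      tauto
    · simp only [mem_sup, mem_sdiff, mem_dom_sdiff, mem_iff_of_le hA]
      have := @mem_dom _ C e
      tauto
  sdiff_le A B := le_iff_subset.2 fun e he => he.1
  inf_sdiff A B := ext_iff'.2 fun e => by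
    simp only [mem_inf, mem_dom_sdiff, not_mem_bot]; tauto
  sup_sdiff A B := ext_iff'.2 fun e => by
    simp only [mem_inf, mem_sup, mem_sdiff, mem_dom_sdiff]
    have := @mem_dom _ A e
    tauto

/-- Every germ lies on a compact clopen section. -/
theorem exists_mem (e : 𝓔.E) : ∃ A : CSec 𝓔, e ∈ A.carrier := by
  obtain ⟨O, hO, hemb⟩ := isLocalHomeomorph_iff_isOpenEmbedding_restrict.1 𝓔.isLocalHomeomorph e
  have heO : e ∈ interior O := mem_interior_iff_mem_nhds.2 hO
  have hinj : Set.InjOn 𝓔.π (interior O) := fun a ha b hb hab =>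
    congrArg Subtype.val (hemb.injective (a₁ := ⟨a, interior_subset ha⟩)
      (a₂ := ⟨b, interior_subset hb⟩) hab)
  obtain ⟨W, hW, hW', heW, hWO⟩ := 𝓔.isLCB.exists_compact_clopen
    (𝓔.isLocalHomeomorph.isOpenMap _ isOpen_interior) (Set.mem_image_of_mem 𝓔.π heO)
  refine ⟨⟨interior O ∩ 𝓔.π ⁻¹' W, csec_iff.2 ⟨isOpen_interior.inter
    (hW'.isOpen.preimage 𝓔.isLocalHomeomorph.continuous), ?_, hinj.mono Set.inter_subset_left⟩⟩,
    heO, heW⟩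
  have himg : O.domRestrict 𝓔.π ⁻¹' W = Subtype.val ⁻¹' (interior O ∩ 𝓔.π ⁻¹' W) := by
    ext ⟨a, ha⟩
    constructor
    · intro h
      refine ⟨?_, h⟩
      obtain ⟨b, hb, hab⟩ := hWO h
      have : (⟨b, interior_subset hb⟩ : O) = ⟨a, ha⟩ := hemb.injective hab
      rw [Subtype.mk.injEq] at this
      exact this ▸ hb
    · exact fun h => h.2
  have hc : IsCompact (O.domRestrict 𝓔.π ⁻¹' W) := by
    refine hemb.isInducing.isCompact_preimage' hW ?_
    intro x hx
    obtain ⟨b, hb, hab⟩ := hWO hx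
    exact ⟨⟨b, interior_subset hb⟩, hab⟩
  have := hc.image continuous_subtype_val
  rwa [himg, Subtype.image_preimage_coe, Set.inter_eq_right.2
    (Set.inter_subset_left.trans interior_subset)] at this

/-- Every compact subset of the base is contained in the domain of a compact clopen section. -/
theorem exists_dom (K : Set 𝓔.X) (hK : IsCompact K) : ∃ A : CSec 𝓔, K ⊆ A.dom := by
  refine hK.induction_on (p := fun K => ∃ A : CSec 𝓔, K ⊆ A.dom) ⟨⊥, Set.empty_subset _⟩
    (fun s t hst ⟨A, hA⟩ => ⟨A, hst.trans hA⟩) ?_ ?_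
  · rintro s t ⟨A, hA⟩ ⟨B, hB⟩
    exact ⟨A ⊔ B, Set.union_subset (fun x hx => mem_dom_sup.2 (Or.inl (hA hx)))
      fun x hx => mem_dom_sup.2 (Or.inr (hB hx))⟩
  · intro x _
    obtain ⟨e, rfl⟩ := 𝓔.surjective x
    obtain ⟨A, hA⟩ := exists_mem e
    exact ⟨A.dom, mem_nhdsWithin_of_mem_nhds (A.dom_spec.2.1.isOpen.mem_nhds (mem_dom hA)),
      A, le_rfl⟩

theorem proj_le_proj_iff {A B : CSec 𝓔} : proj A ≤ proj B ↔ A.dom ⊆ B.dom := by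
  rw [proj_le_iff, ext_iff']
  simp only [mem_inf]
  constructor
  · rintro h _ ⟨e, he, rfl⟩
    exact ((h e).2 he).2
  · intro h e
    exact ⟨fun h => h.1, fun he => ⟨he, h (mem_dom he)⟩⟩

end CSec

/-- The action of a morphism on sections: `A` over `U` is sent to the section
`x ↦ k x (A (f x))` over `f ⁻¹ U`. -/
def LCBSh.Hom.mapSec {𝓑 𝓐 : LCBSh.{u}} (k : LCBSh.Hom 𝓑 𝓐) (A : CSec 𝓑) : CSec 𝓐 where
  carrier := {e | ∃ (x : 𝓐.X) (a : 𝓑.E) (h : 𝓑.π a = k.base x), a ∈ A.carrier ∧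
    k.cohom.map x a h = e}
  isSection := by
    obtain ⟨h₁, h₂, s, hs, hA⟩ := A.dom_spec
    refine ⟨_, k.base_proper _ h₁, h₂.preimage k.base_continuous, _,
      k.cohom.isSection_map _ h₂.isOpen s hs, ?_⟩
    ext e
    constructor
    · rintro ⟨x, rfl⟩
      exact ⟨x, _, hs.π_apply _, hA ▸ Set.mem_range_self _, rfl⟩
    · rintro ⟨x, a, h, ha, rfl⟩
      have ha' := ha
      rw [← hA] at ha'
      obtain ⟨y, rfl⟩ := ha'
      have hy : (y : 𝓑.X) = k.base x := (hs.π_apply y).symm.trans h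
      refine ⟨⟨x, Set.mem_preimage.2 (by rw [← hy]; exact y.2)⟩, ?_⟩
      change k.cohom.map x _ _ = _
      congr 1
      exact congrArg s (Subtype.ext hy.symm)

theorem mem_mapSec {𝓑 𝓐 : LCBSh.{u}} {k : LCBSh.Hom 𝓑 𝓐} {A : CSec 𝓑} {e : 𝓐.E} :
    e ∈ (k.mapSec A).carrier ↔ ∃ (a : 𝓑.E) (h : 𝓑.π a = k.base (𝓐.π e)), a ∈ A.carrier ∧
      k.cohom.map (𝓐.π e) a h = e := by
  constructor
  · rintro ⟨x, a, h, ha, rfl⟩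
    have hx := k.cohom.π_map x a h
    refine ⟨a, by rw [hx]; exact h, ha, ?_⟩
    congr 1
  · rintro ⟨a, h, ha, he⟩
    exact ⟨_, a, h, ha, he⟩

theorem mem_dom_mapSec {𝓑 𝓐 : LCBSh.{u}} {k : LCBSh.Hom 𝓑 𝓐} {A : CSec 𝓑} {x : 𝓐.X} :
    x ∈ (k.mapSec A).dom ↔ k.base x ∈ A.dom := by
  constructor
  · rintro ⟨_, ⟨x, a, h, ha, rfl⟩, rfl⟩
    rw [k.cohom.π_map, ← h]
    exact CSec.mem_dom ha
  · rintro ⟨a, ha, h⟩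
    exact ⟨_, ⟨x, a, h, ha, rfl⟩, k.cohom.π_map _ _ _⟩

/-- The homomorphism of dual skew Boolean algebras induced by a morphism of étale spaces. -/
def LCBSh.Hom.toSBAHom {𝓑 𝓐 : LCBSh.{u}} (k : LCBSh.Hom 𝓑 𝓐) : SBAHom (CSec 𝓑) (CSec 𝓐) where
  toFun := k.mapSec
  map_inf A B := CSec.ext_iff'.2 fun e => by
    rw [CSec.mem_inf, mem_dom_mapSec, mem_mapSec, mem_mapSec]
    constructor
    · rintro ⟨a, h, ⟨h₁, h₂⟩, h₃⟩
      exact ⟨⟨a, h, h₁, h₃⟩, h ▸ h₂⟩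
    · rintro ⟨⟨a, h, h₁, h₃⟩, h₂⟩
      exact ⟨a, h, ⟨h₁, Set.mem_preimage.2 (h ▸ h₂)⟩, h₃⟩
  map_sup A B := CSec.ext_iff'.2 fun e => by
    rw [CSec.mem_sup, mem_dom_mapSec, mem_mapSec, mem_mapSec, mem_mapSec]
    constructor
    · rintro ⟨a, h, h₁ | h₁, h₃⟩
      · exact Or.inl ⟨a, h, h₁, h₃⟩
      · exact Or.inr ⟨⟨a, h, h₁.1, h₃⟩, h ▸ h₁.2⟩
    · rintro (⟨a, h, h₁, h₃⟩ | ⟨⟨a, h, h₁, h₃⟩, h₂⟩)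
      · exact ⟨a, h, Or.inl h₁, h₃⟩
      · exact ⟨a, h, Or.inr ⟨h₁, fun h' => h₂ (h ▸ h')⟩, h₃⟩
  map_sdiff A B := CSec.ext_iff'.2 fun e => by
    rw [CSec.mem_sdiff, mem_dom_mapSec, mem_mapSec, mem_mapSec]
    constructor
    · rintro ⟨a, h, ⟨h₁, h₂⟩, h₃⟩
      exact ⟨⟨a, h, h₁, h₃⟩, h ▸ h₂⟩
    · rintro ⟨⟨a, h, h₁, h₃⟩, h₂⟩
      exact ⟨a, h, ⟨h₁, fun h' => h₂ (h ▸ h')⟩, h₃⟩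
  map_bot := CSec.ext_iff'.2 fun e =>
    ⟨fun ⟨_, _, _, ha, _⟩ => (CSec.not_mem_bot ha).elim, fun h => (CSec.not_mem_bot h).elim⟩

theorem LCBSh.Hom.toSBAHom_isProper {𝓑 𝓐 : LCBSh.{u}} (k : LCBSh.Hom 𝓑 𝓐) :
    k.toSBAHom.IsProper := by
  intro c
  obtain ⟨C, rfl⟩ := proj_surjective c
  obtain ⟨A, hA⟩ := CSec.exists_dom _ (C.dom_spec.1.image k.base_continuous)
  refine ⟨proj A, ?_⟩
  rw [SBAHom.induced_proj, CSec.proj_le_proj_iff]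
  intro x hx
  exact mem_dom_mapSec.2 (hA (Set.mem_image_of_mem _ hx))

end Sections

/-- The functor `SB` from étale spaces over locally compact Boolean spaces to left-handed skew
Boolean algebras: an étale space is sent to the skew Boolean algebra of its compact clopen
sections, a cohomomorphism to its action on sections. -/
def SB : LCBSh.{u} ⥤ SkewB.{u} where
  obj 𝓔 := ⟨CSec 𝓔⟩
  map k := ⟨k.toSBAHom, k.toSBAHom_isProper⟩
  map_id 𝓔 := SkewB.Hom.ext (SBAHom.ext (funext fun A => CSec.ext_iff'.2 fun e => by
    constructor
    · rintro ⟨x, a, h, ha, rfl⟩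
      exact ha
    · intro he
      exact ⟨_, e, rfl, he, rfl⟩))
  map_comp {_ 𝓑 _} k l := SkewB.Hom.ext (SBAHom.ext (funext fun A => CSec.ext_iff'.2 fun e => by
    constructor
    · rintro ⟨x, a, h, ha, rfl⟩
      exact ⟨x, _, k.cohom.π_map _ _ _, ⟨_, a, h, ha, rfl⟩, rfl⟩
    · rintro ⟨x, b, h, ⟨y, a, h', ha, rfl⟩, rfl⟩
      obtain rfl : y = LCBSh.Hom.base l x := (k.cohom.π_map y a h').symm.trans h
      exact ⟨x, a, h', ha, rfl⟩))

/-! ## The spectrum of a generalized Boolean algebra -/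

/-- A prime filter of a generalized Boolean algebra. -/
@[ext]
structure BAPrimeFilter (B : Type u) [GeneralizedBooleanAlgebra B] : Type u where
  carrier : Set B
  nonempty : carrier.Nonempty
  mem_of_le : ∀ a b : B, a ∈ carrier → a ≤ b → b ∈ carrier
  inf_mem : ∀ a b : B, a ∈ carrier → b ∈ carrier → a ⊓ b ∈ carrier
  bot_not_mem : ⊥ ∉ carrier
  mem_or_mem : ∀ a b : B, a ⊔ b ∈ carrier → a ∈ carrier ∨ b ∈ carrier

namespace BAPrimeFilter

variable {B : Type u} [GeneralizedBooleanAlgebra B]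

/-- The set `M'(a)` of prime filters containing `a`. -/
def M' (a : B) : Set (BAPrimeFilter B) := {F | a ∈ F.carrier}

/-- The topology generated by the sets `M'(a)`. -/
instance : TopologicalSpace (BAPrimeFilter B) := TopologicalSpace.generateFrom (Set.range M')

theorem isOpen_M' (a : B) : IsOpen (M' a) := isOpen_generateFrom_of_mem ⟨a, rfl⟩

theorem mem_inf_iff (F : BAPrimeFilter B) {a b : B} :
    a ⊓ b ∈ F.carrier ↔ a ∈ F.carrier ∧ b ∈ F.carrier :=
  ⟨fun h => ⟨F.mem_of_le _ _ h inf_le_left, F.mem_of_le _ _ h inf_le_right⟩,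
    fun h => F.inf_mem _ _ h.1 h.2⟩

theorem mem_sup_iff (F : BAPrimeFilter B) {a b : B} :
    a ⊔ b ∈ F.carrier ↔ a ∈ F.carrier ∨ b ∈ F.carrier :=
  ⟨F.mem_or_mem a b, fun h => h.elim (fun h => F.mem_of_le _ _ h le_sup_left)
    fun h => F.mem_of_le _ _ h le_sup_right⟩

theorem sdiff_mem (F : BAPrimeFilter B) {a b : B} (hb : b ∈ F.carrier) (ha : a ∉ F.carrier) :
    b \ a ∈ F.carrier := by
  rw [← sup_inf_sdiff b a, mem_sup_iff, mem_inf_iff] at hb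
  tauto

theorem not_mem_of_sdiff (F : BAPrimeFilter B) {a b : B} (h : b \ a ∈ F.carrier) :
    a ∉ F.carrier := fun ha => F.bot_not_mem (by
  have := F.inf_mem _ _ ha h
  rwa [inf_sdiff_self_right] at this)

theorem isTopologicalBasis : IsTopologicalBasis (Set.range (M' : B → Set (BAPrimeFilter B))) where
  exists_subset_inter := by
    rintro _ ⟨a, rfl⟩ _ ⟨b, rfl⟩ F hF
    exact ⟨_, ⟨a ⊓ b, rfl⟩, F.mem_inf_iff.2 hF, fun G hG => G.mem_inf_iff.1 hG⟩
  sUnion_eq := Set.eq_univ_of_forall fun F => by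
    obtain ⟨a, ha⟩ := F.nonempty
    exact ⟨_, ⟨a, rfl⟩, ha⟩
  eq_generateFrom := rfl

theorem isClopen_M' (a : B) : IsClopen (M' a) := by
  refine ⟨⟨isOpen_iff_forall_mem_open.2 fun F hF => ?_⟩, isOpen_M' a⟩
  obtain ⟨b, hb⟩ := F.nonempty
  exact ⟨M' (b \ a), fun G hG => G.not_mem_of_sdiff hG, isOpen_M' _, F.sdiff_mem hb hF⟩

theorem isCompact_M' (a : B) : IsCompact (M' a) := by
  rw [isCompact_iff_ultrafilter_le_nhds]
  intro 𝒰 h𝒰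
  have ha : M' a ∈ 𝒰 := Filter.le_principal_iff.1 h𝒰
  let F : BAPrimeFilter B :=
    { carrier := {b | M' b ∈ 𝒰}
      nonempty := ⟨a, ha⟩
      mem_of_le := fun b c hb hbc => Filter.mem_of_superset hb fun G hG => G.mem_of_le _ _ hG hbc
      inf_mem := fun b c hb hc => Filter.mem_of_superset (Filter.inter_mem hb hc)
        fun G hG => G.inf_mem _ _ hG.1 hG.2
      bot_not_mem := fun h => by
        have : (M' (⊥ : B)) = ∅ := Set.eq_empty_of_forall_notMem fun G hG => G.bot_not_mem hG
        rw [Set.mem_ofPred_eq, this] at h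
        exact 𝒰.empty_notMem h
      mem_or_mem := fun b c h => by
        have hbc : M' (b ⊔ c) = M' b ∪ M' c := Set.ext fun G => G.mem_sup_iff
        rw [Set.mem_ofPred_eq, hbc] at h
        exact Ultrafilter.union_mem_iff.1 h }
  refine ⟨F, ha, ?_⟩
  rw [TopologicalSpace.nhds_generateFrom]
  refine le_iInf₂ ?_
  rintro _ ⟨hF, ⟨b, rfl⟩⟩
  exact Filter.le_principal_iff.2 hF

/-- The spectrum of a generalized Boolean algebra is a locally compact Boolean space. -/
theorem isLCBSpace : IsLCBSpace (BAPrimeFilter B) where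
  t2 := ⟨fun F G hFG => by
    obtain ⟨a, ha⟩ : ∃ a, ¬ (a ∈ F.carrier ↔ a ∈ G.carrier) := by
      by_contra! h
      exact hFG (BAPrimeFilter.ext (Set.ext h))
    have hd : ∀ b : B, Disjoint (M' a) (M' (b \ a)) := fun b =>
      Set.disjoint_left.2 fun H h₁ h₂ => H.not_mem_of_sdiff h₂ h₁
    by_cases h : a ∈ F.carrier
    · obtain ⟨b, hb⟩ := G.nonempty
      exact ⟨M' a, M' (b \ a), isOpen_M' _, isOpen_M' _, h, G.sdiff_mem hb (by tauto), hd b⟩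
    · obtain ⟨b, hb⟩ := F.nonempty
      exact ⟨M' (b \ a), M' a, isOpen_M' _, isOpen_M' _, F.sdiff_mem hb h,
        (by tauto : a ∈ G.carrier), (hd b).symm⟩⟩
  locallyCompact F := by
    obtain ⟨a, ha⟩ := F.nonempty
    exact ⟨M' a, isCompact_M' a, by rwa [(isOpen_M' a).interior_eq]⟩
  clopenBasis := isTopologicalBasis_of_isOpen_of_nhds (fun _ h => h.isOpen) fun F O hF hO => by
    obtain ⟨_, ⟨a, rfl⟩, h₁, h₂⟩ := isTopologicalBasis.exists_subset_of_mem_open hF hO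
    exact ⟨_, isClopen_M' a, h₁, h₂⟩

end BAPrimeFilter

/-! ## The spectrum of a skew Boolean algebra -/

section Spectrum

variable {S T R : Type u} [SkewBooleanAlgebra S] [SkewBooleanAlgebra T] [SkewBooleanAlgebra R]

/-- A filter of a skew Boolean algebra. -/
structure IsSkewFilter (U : Set S) : Prop where
  nonempty : U.Nonempty
  mem_of_le : ∀ a b : S, a ∈ U → a ≤ b → b ∈ U
  inf_mem : ∀ a b : S, a ∈ U → b ∈ U → a ⊓ b ∈ U

/-- `U` is a preprime filter over the prime filter `F` of `S / D`: a filter whose image in `S / D`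
is `F`. -/
def IsPreprimeOver (F : BAPrimeFilter (MaxLat S)) (U : Set S) : Prop :=
  IsSkewFilter U ∧ proj '' U = F.carrier

variable (S) in
/-- The prime filters of a skew Boolean algebra `S`: the minimal elements of the set of
preprime filters over `F`, where `F` (which is determined by the filter) runs through the prime
filters of `S / D`. -/
structure SBAPrimeFilter : Type u where
  base : BAPrimeFilter (MaxLat S)
  carrier : Set S
  minimal : Minimal (IsPreprimeOver base) carrier

namespace SBAPrimeFilter

theorem ext' {U V : SBAPrimeFilter S} (h : U.carrier = V.carrier) : U = V := by
  obtain ⟨F, U, hU⟩ := U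
  obtain ⟨G, V, hV⟩ := V
  obtain rfl : U = V := h
  obtain rfl : F = G := BAPrimeFilter.ext (hU.1.2.symm.trans hV.1.2)
  rfl

theorem proj_mem (U : SBAPrimeFilter S) {a : S} (h : a ∈ U.carrier) : proj a ∈ U.base.carrier := by
  rw [← U.minimal.1.2]
  exact ⟨a, h, rfl⟩

/-- The set of all `s` lying above some `t ≤ a` with `proj t ∈ F`. -/
def X (a : S) (F : BAPrimeFilter (MaxLat S)) : Set S :=
  {s | ∃ t, proj t ∈ F.carrier ∧ t ≤ a ∧ t ≤ s}

theorem X_subset {F : BAPrimeFilter (MaxLat S)} {U : Set S} (hU : IsPreprimeOver F U) {a : S}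
    (ha : a ∈ U) : X a F ⊆ U := by
  rintro s ⟨t, ht, hta, hts⟩
  rw [← hU.2] at ht
  obtain ⟨y, hy, hyt⟩ := ht
  have h : a ⊓ y = t := by
    refine eq_of_le_of_proj_eq (inf_le_self a y) hta ?_
    rw [proj_inf, hyt, inf_eq_right]
    exact proj_mono hta
  exact hU.1.mem_of_le t s (h ▸ hU.1.inf_mem _ _ ha hy) hts

theorem minimal_X {F : BAPrimeFilter (MaxLat S)} {a : S} (ha : proj a ∈ F.carrier) :
    Minimal (IsPreprimeOver F) (X a F) := by
  refine ⟨⟨⟨⟨a, a, ha, le_rfl, le_rfl⟩, ?_, ?_⟩, ?_⟩, ?_⟩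
  · rintro s s' ⟨t, h₁, h₂, h₃⟩ h
    exact ⟨t, h₁, h₂, h₃.trans h⟩
  · rintro s s' ⟨t, h₁, h₂, h₃⟩ ⟨t', h₁', h₂', h₃'⟩
    have hc : t ⊓ t' = t' ⊓ t := SkewBooleanAlgebra.principal_inf_comm a t t' h₂ h₂'
    have h₄ : t ⊓ t' ≤ t := inf_le_self t t'
    have h₅ : t ⊓ t' ≤ t' := hc ▸ inf_le_self t' t
    refine ⟨t ⊓ t', ?_, h₄.trans h₂, ?_⟩
    · rw [proj_inf]
      exact F.inf_mem _ _ h₁ h₁'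
    · have h₆ := h₄.trans h₃
      have h₇ := h₅.trans h₃'
      refine ⟨?_, ?_⟩
      · rw [← SkewLattice.meet_assoc, h₆.1, h₇.1]
      · rw [SkewLattice.meet_assoc, h₇.2, h₆.2]
  · ext d
    constructor
    · rintro ⟨s, ⟨t, h₁, h₂, h₃⟩, rfl⟩
      exact F.mem_of_le _ _ h₁ (proj_mono h₃)
    · intro hd
      obtain ⟨d, rfl⟩ := proj_surjective d
      refine ⟨d ⊔ (a ⊓ d), ⟨a ⊓ d, F.inf_mem _ _ ha hd, inf_le_self a d, self_le_sup _ _⟩, ?_⟩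
      rw [proj_sup, proj_inf, sup_eq_left]
      exact inf_le_right
  · intro U hU hUX
    have h : proj a ∈ proj '' U := hU.2 ▸ ha
    obtain ⟨b, hb, hba⟩ := h
    obtain ⟨t, h₁, h₂, h₃⟩ := hUX hb
    have ht : t ∈ U := X_subset hU hb ⟨t, h₁, h₃, le_rfl⟩
    exact X_subset hU (hU.1.mem_of_le _ _ ht h₂)

theorem eq_X (U : SBAPrimeFilter S) {a : S} (ha : a ∈ U.carrier) : U.carrier = X a U.base :=
  (U.minimal.eq_of_subset (minimal_X (U.proj_mem ha)).1 (X_subset U.minimal.1 ha)).symm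

/-- The prime filter over `F` containing `a`. -/
def mk' (a : S) (F : BAPrimeFilter (MaxLat S)) (ha : proj a ∈ F.carrier) : SBAPrimeFilter S :=
  ⟨F, X a F, minimal_X ha⟩

theorem mem_mk' (a : S) (F : BAPrimeFilter (MaxLat S)) (ha : proj a ∈ F.carrier) :
    a ∈ (mk' a F ha).carrier := ⟨a, ha, le_rfl, le_rfl⟩

theorem eq_of_mem {U V : SBAPrimeFilter S} (h : U.base = V.base) {a : S} (hU : a ∈ U.carrier)
    (hV : a ∈ V.carrier) : U = V :=
  ext' (by rw [U.eq_X hU, V.eq_X hV, h])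

/-- The set `M(a)` of prime filters containing `a`. -/
def M (a : S) : Set (SBAPrimeFilter S) := {U | a ∈ U.carrier}

/-- The topology whose subbase are the sets `M(a)`. -/
instance : TopologicalSpace (SBAPrimeFilter S) := TopologicalSpace.generateFrom (Set.range M)

theorem isOpen_M (a : S) : IsOpen (M a) := isOpen_generateFrom_of_mem ⟨a, rfl⟩

theorem isTopologicalBasis : IsTopologicalBasis (Set.range (M : S → Set (SBAPrimeFilter S))) where
  exists_subset_inter := by
    rintro _ ⟨a, rfl⟩ _ ⟨b, rfl⟩ U ⟨ha, hb⟩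
    change b ∈ U.carrier at hb
    rw [U.eq_X ha] at hb
    obtain ⟨t, h₁, h₂, h₃⟩ := hb
    refine ⟨_, ⟨t, rfl⟩, ?_, fun V hV =>
      ⟨V.minimal.1.1.mem_of_le _ _ hV h₂, V.minimal.1.1.mem_of_le _ _ hV h₃⟩⟩
    change t ∈ U.carrier
    rw [U.eq_X ha]
    exact ⟨t, h₁, h₂, le_rfl⟩
  sUnion_eq := Set.eq_univ_of_forall fun U => by
    obtain ⟨a, ha⟩ := U.minimal.1.1.nonempty
    exact ⟨_, ⟨a, rfl⟩, ha⟩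
  eq_generateFrom := rfl

theorem base_image_M (a : S) : base '' M a = BAPrimeFilter.M' (proj a) := by
  ext F
  constructor
  · rintro ⟨U, hU, rfl⟩
    exact U.proj_mem hU
  · intro hF
    exact ⟨mk' a F hF, mem_mk' a F hF, rfl⟩

theorem isOpenMap_base : IsOpenMap (base : SBAPrimeFilter S → _) := by
  rw [isTopologicalBasis.isOpenMap_iff]
  rintro _ ⟨a, rfl⟩
  rw [base_image_M]
  exact BAPrimeFilter.isOpen_M' _

theorem continuous_base : Continuous (base : SBAPrimeFilter S → _) := by
  rw [BAPrimeFilter.isTopologicalBasis.continuous_iff]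
  rintro _ ⟨b, rfl⟩
  refine isOpen_iff_forall_mem_open.2 fun U hU => ?_
  have hU : b ∈ U.base.carrier := hU
  rw [← U.minimal.1.2] at hU
  obtain ⟨a, ha, rfl⟩ := hU
  exact ⟨M a, fun V hV => V.proj_mem hV, isOpen_M a, ha⟩

theorem isLocalHomeomorph_base : IsLocalHomeomorph (base : SBAPrimeFilter S → _) := by
  rw [isLocalHomeomorph_iff_isOpenEmbedding_restrict]
  intro U
  obtain ⟨a, ha⟩ := U.minimal.1.1.nonempty
  refine ⟨M a, (isOpen_M a).mem_nhds ha, .of_continuous_injective_isOpenMap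
    (continuous_base.comp continuous_subtype_val) ?_
    (isOpenMap_base.comp (isOpen_M a).isOpenMap_subtype_val)⟩
  rintro ⟨V, hV⟩ ⟨W, hW⟩ h
  exact Subtype.ext (eq_of_mem h hV hW)

theorem surjective_base : Function.Surjective (base : SBAPrimeFilter S → _) := fun F => by
  obtain ⟨d, hd⟩ := F.nonempty
  obtain ⟨a, rfl⟩ := proj_surjective d
  exact ⟨mk' a F hd, rfl⟩

end SBAPrimeFilter

variable (S) in
/-- The dual étale space `(S*, f, (S / D)*)` of a skew Boolean algebra `S`: the covering map `f`
sends a prime filter of `S` over `F` to `F`. -/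
def dualEtale : LCBSh.{u} where
  X := BAPrimeFilter (MaxLat S)
  E := SBAPrimeFilter S
  isLCB := BAPrimeFilter.isLCBSpace
  π := SBAPrimeFilter.base
  isLocalHomeomorph := SBAPrimeFilter.isLocalHomeomorph_base
  surjective := SBAPrimeFilter.surjective_base

namespace SBAHom

/-- The map `(S / D)* → (T / D)*` sending `F` to its preimage under the map `T / D → S / D`
induced by a proper homomorphism `k : T → S`. -/
def dualBase (k : SBAHom T S) (hk : k.IsProper) (F : BAPrimeFilter (MaxLat S)) :
    BAPrimeFilter (MaxLat T) where
  carrier := k.induced ⁻¹' F.carrier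
  nonempty := by
    obtain ⟨c, hc⟩ := F.nonempty
    obtain ⟨b, hb⟩ := hk c
    exact ⟨b, F.mem_of_le _ _ hc hb⟩
  mem_of_le a b ha hab := F.mem_of_le _ _ ha (k.induced_mono hab)
  inf_mem a b ha hb := by
    rw [Set.mem_preimage, k.induced_inf]
    exact F.inf_mem _ _ ha hb
  bot_not_mem h := F.bot_not_mem (by rwa [Set.mem_preimage, k.induced_bot] at h)
  mem_or_mem a b h := F.mem_or_mem _ _ (by rwa [Set.mem_preimage, k.induced_sup] at h)

theorem continuous_dualBase (k : SBAHom T S) (hk : k.IsProper) : Continuous (k.dualBase hk) := by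
  rw [BAPrimeFilter.isTopologicalBasis.continuous_iff]
  rintro _ ⟨b, rfl⟩
  exact BAPrimeFilter.isOpen_M' (k.induced b)

theorem isCompact_preimage_dualBase (k : SBAHom T S) (hk : k.IsProper)
    (K : Set (BAPrimeFilter (MaxLat T))) (hK : IsCompact K) : IsCompact (k.dualBase hk ⁻¹' K) := by
  obtain ⟨b, hb⟩ : ∃ b : MaxLat T, K ⊆ BAPrimeFilter.M' b := by
    refine hK.induction_on (p := fun K => ∃ b : MaxLat T, K ⊆ BAPrimeFilter.M' b)
      ⟨⊥, Set.empty_subset _⟩ (fun s t hst ⟨b, hb⟩ => ⟨b, hst.trans hb⟩) ?_ ?_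
    · rintro s t ⟨b, hb⟩ ⟨c, hc⟩
      exact ⟨b ⊔ c, Set.union_subset (fun F hF => F.mem_sup_iff.2 (Or.inl (hb hF)))
        fun F hF => F.mem_sup_iff.2 (Or.inr (hc hF))⟩
    · intro F _
      obtain ⟨b, hb⟩ := F.nonempty
      exact ⟨_, mem_nhdsWithin_of_mem_nhds ((BAPrimeFilter.isOpen_M' b).mem_nhds hb), b, le_rfl⟩
  have := (BAPrimeFilter.isLCBSpace (B := MaxLat T)).t2
  exact (BAPrimeFilter.isCompact_M' (k.induced b)).of_isClosed_subset
    (hK.isClosed.preimage (k.continuous_dualBase hk)) fun F hF => hb hF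

/-- For a prime filter `U` of `T` over the image of `F`, there is a unique prime filter `V` of `S`
over `F` with `U ⊆ k ⁻¹ V`. -/
theorem existsUnique_stalkMap (k : SBAHom T S) (hk : k.IsProper) (F : BAPrimeFilter (MaxLat S))
    (U : SBAPrimeFilter T) (hU : U.base = k.dualBase hk F) :
    ∃! V : SBAPrimeFilter S, V.base = F ∧ U.carrier ⊆ k.toFun ⁻¹' V.carrier := by
  obtain ⟨a, ha⟩ := U.minimal.1.1.nonempty
  have haF : proj (k.toFun a) ∈ F.carrier := by
    have h := U.proj_mem ha
    rw [hU] at h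
    exact h
  refine ⟨SBAPrimeFilter.mk' (k.toFun a) F haF, ⟨rfl, ?_⟩, ?_⟩
  · intro b hb
    rw [U.eq_X ha, hU] at hb
    obtain ⟨t, h₁, h₂, h₃⟩ := hb
    exact ⟨k.toFun t, h₁, k.map_le h₂, k.map_le h₃⟩
  · rintro V ⟨rfl, hV⟩
    exact SBAPrimeFilter.eq_of_mem rfl (hV ha) (SBAPrimeFilter.mem_mk' _ _ _)

/-- The stalk map `k_F` from the stalk of `T*` at the image of `F` to the stalk of `S*` at `F`:
`k_F(U)` is the prime filter `V` over `F` with `U ⊆ k ⁻¹ V`. -/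
noncomputable def stalkMap (k : SBAHom T S) (hk : k.IsProper) (F : BAPrimeFilter (MaxLat S))
    (U : SBAPrimeFilter T) (hU : U.base = k.dualBase hk F) : SBAPrimeFilter S :=
  (k.existsUnique_stalkMap hk F U hU).choose

theorem stalkMap_base (k : SBAHom T S) (hk : k.IsProper) (F : BAPrimeFilter (MaxLat S))
    (U : SBAPrimeFilter T) (hU : U.base = k.dualBase hk F) : (k.stalkMap hk F U hU).base = F :=
  (k.existsUnique_stalkMap hk F U hU).choose_spec.1.1

theorem mem_stalkMap (k : SBAHom T S) (hk : k.IsProper) (F : BAPrimeFilter (MaxLat S))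
    (U : SBAPrimeFilter T) (hU : U.base = k.dualBase hk F) {a : T} (ha : a ∈ U.carrier) :
    k.toFun a ∈ (k.stalkMap hk F U hU).carrier :=
  (k.existsUnique_stalkMap hk F U hU).choose_spec.1.2 ha

theorem stalkMap_eq (k : SBAHom T S) (hk : k.IsProper) (F : BAPrimeFilter (MaxLat S))
    (U : SBAPrimeFilter T) (hU : U.base = k.dualBase hk F) (V : SBAPrimeFilter S)
    (hV : V.base = F) (h : ∀ a ∈ U.carrier, k.toFun a ∈ V.carrier) :
    k.stalkMap hk F U hU = V :=
  ((k.existsUnique_stalkMap hk F U hU).choose_spec.2 V ⟨hV, h⟩).symm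

theorem stalkMap_carrier (k : SBAHom T S) (hk : k.IsProper) (F : BAPrimeFilter (MaxLat S))
    (U : SBAPrimeFilter T) (hU : U.base = k.dualBase hk F) {a : T} (ha : a ∈ U.carrier) :
    (k.stalkMap hk F U hU).carrier = SBAPrimeFilter.X (k.toFun a) F := by
  rw [SBAPrimeFilter.eq_X _ (k.mem_stalkMap hk F U hU ha), stalkMap_base]

/-- The morphism of dual étale spaces `T* ⇝ S*` induced by a proper homomorphism `k : T → S`. -/
noncomputable def dualHom (k : SBAHom T S) (hk : k.IsProper) :
    LCBSh.Hom (dualEtale T) (dualEtale S) where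
  base := k.dualBase hk
  base_continuous := k.continuous_dualBase hk
  base_proper := k.isCompact_preimage_dualBase hk
  cohom :=
    { map := k.stalkMap hk
      π_map := k.stalkMap_base hk
      isSection_map := fun O hO s hs => by
        refine ⟨?_, fun F => k.stalkMap_base hk _ _ _⟩
        refine SBAPrimeFilter.isTopologicalBasis.continuous_iff.2 ?_
        rintro _ ⟨c, rfl⟩
        refine isOpen_iff_forall_mem_open.2 fun F hF => ?_
        let j : (k.dualBase hk ⁻¹' O) → O := fun G => ⟨k.dualBase hk G, G.2⟩
        have hj : Continuous j :=
          ((k.continuous_dualBase hk).comp continuous_subtype_val).subtype_mk _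
        have hsj : Continuous (fun G => s (j G)) := hs.continuous.comp hj
        obtain ⟨a, ha⟩ := (s (j F)).minimal.1.1.nonempty
        have hF : c ∈ (k.stalkMap hk F.1 (s (j F)) (hs.π_apply _)).carrier := hF
        rw [k.stalkMap_carrier hk F.1 _ (hs.π_apply _) ha] at hF
        obtain ⟨t, h₁, h₂, h₃⟩ := hF
        refine ⟨(fun G => s (j G)) ⁻¹' SBAPrimeFilter.M a ∩
          Subtype.val ⁻¹' BAPrimeFilter.M' (proj t), ?_,
          ((SBAPrimeFilter.isOpen_M a).preimage hsj).inter
            ((BAPrimeFilter.isOpen_M' _).preimage continuous_subtype_val), ha, h₁⟩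
        rintro G ⟨hG, hG'⟩
        change c ∈ (k.stalkMap hk G.1 (s (j G)) (hs.π_apply _)).carrier
        rw [k.stalkMap_carrier hk G.1 _ (hs.π_apply _) hG]
        exact ⟨t, hG', h₂, h₃⟩ }

end SBAHom

end Spectrum

/-- The functor `ES` from left-handed skew Boolean algebras to étale spaces over locally compact
Boolean spaces: a skew Boolean algebra is sent to its dual étale space. -/
noncomputable def ES : SkewB.{u} ⥤ LCBSh.{u} where
  obj S := dualEtale S.carrier
  map k := k.hom.dualHom k.proper
  map_id S := LCBSh.Hom.ext'
    (fun F => BAPrimeFilter.ext (Set.ext fun a => by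
      obtain ⟨x, rfl⟩ := proj_surjective a
      exact Iff.rfl))
    (fun F U h h' => SBAHom.stalkMap_eq (𝟙 S : S ⟶ S).hom (𝟙 S : S ⟶ S).proper F U h U h'
      fun a ha => ha)
  map_comp k l := LCBSh.Hom.ext'
    (fun F => BAPrimeFilter.ext (Set.ext fun a => by
      obtain ⟨x, rfl⟩ := proj_surjective a
      exact Iff.rfl))
    (fun F U h h' => SBAHom.stalkMap_eq (k ≫ l).hom (k ≫ l).proper F U h _
      (SBAHom.stalkMap_base l.hom l.proper F _
        (SBAHom.stalkMap_base k.hom k.proper (l.hom.dualBase l.proper F) U h'))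
      fun _ ha => SBAHom.mem_stalkMap l.hom l.proper F _
        (SBAHom.stalkMap_base k.hom k.proper (l.hom.dualBase l.proper F) U h')
        (SBAHom.mem_stalkMap k.hom k.proper (l.hom.dualBase l.proper F) U h' ha))

end SkewStone

namespace SkewStone

/-! ## The prime filter theorem and the sections `M a` -/

namespace BAPrimeFilter

variable {B : Type u} [GeneralizedBooleanAlgebra B]

/-! The equivalence is Stone duality carried out stalkwise. An element `a` of `S` is represented by
the set `M a` of prime filters containing it, a section of the dual étale space over the compact
clopen set of prime filters containing `proj a`. A germ `e` of an étale space is represented by the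
set of compact clopen sections through it. Both representations have to be shown bijective,
structure preserving and natural.

For algebras, the description `X a F` of a prime filter shows that, once `a` is known to lie in it,
the elements below `a` are tested in `S / D` alone (`mem_of_proj_mem`). Hence `M` turns the
operations of `S` into those of sections. Compactness glues local data by joins: local comparison
gives injectivity (`le_of_M_subset`), and covering by basic sets gives surjectivity (`exists_M_eq`).
For spaces, points correspond to prime filters of the algebra of domains by compactness and the
Hausdorff property (`pointFilter_surjective`, `pointFilter_injective`). Germs then correspond to
prime filters because the minimal filter cut out by a section through `e` consists of all sections
through `e` (`X_pointFilter`).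

The restriction rests on a second dictionary. Natural order is inclusion of sections, so `∩` is
set-theoretic intersection; binary meets exist exactly when intersections of compact clopen sections
are again such sections. A homomorphism that preserves `∩` cannot identify two germs
(`LSBIA.dualHom_isInjective`), and an injective cohomomorphism commutes with intersections of
sections (`ESLCBSE.mapSec_inter`). -/

theorem exists_mem_not_mem {a b : B} (h : ¬a ≤ b) :
    ∃ F : BAPrimeFilter B, a ∈ F.carrier ∧ b ∉ F.carrier := by
  obtain ⟨J, hJ, hbJ, hd⟩ := DistribLattice.prime_ideal_of_disjoint_filter_ideal
    (F := Order.PFilter.principal a) (I := Order.Ideal.principal b)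
    (Set.disjoint_left.2 fun c hc hc' => h (le_trans (Order.PFilter.mem_principal.1 hc)
      (Order.Ideal.mem_principal.1 hc')))
  have ha : a ∉ J := Set.disjoint_left.1 hd (Order.PFilter.mem_principal.2 le_rfl)
  have hb : b ∈ J := hbJ (Order.Ideal.mem_principal.2 le_rfl)
  -- The complement of the prime ideal is the required filter: primality of `J` gives closure under
  -- meets, and closure of `J` under joins gives primality of the filter.
  refine ⟨⟨{c | c ∉ J}, ⟨a, ha⟩, fun c d hc hcd hd => hc (J.lower hcd hd), fun c d hc hd h => ?_,
    fun h => h (J.lower bot_le hb), fun c d h => ?_⟩, ha, fun h => h hb⟩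
  · exact (hJ.mem_or_mem h).elim hc hd
  · by_contra! h'
    simp only [Set.mem_ofPred_eq, not_not] at h'
    exact h (Order.Ideal.sup_mem h'.1 h'.2)

theorem M'_subset_iff {a b : B} : M' a ⊆ M' b ↔ a ≤ b := by
  refine ⟨fun h => ?_, fun h F hF => F.mem_of_le _ _ hF h⟩
  by_contra hab
  obtain ⟨F, ha, hb⟩ := exists_mem_not_mem hab
  exact hb (h ha)

theorem sdiff_mem_iff (F : BAPrimeFilter B) {a b : B} :
    a \ b ∈ F.carrier ↔ a ∈ F.carrier ∧ b ∉ F.carrier :=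
  ⟨fun h => ⟨F.mem_of_le _ _ h sdiff_le, F.not_mem_of_sdiff h⟩, fun h => F.sdiff_mem h.1 h.2⟩

end BAPrimeFilter

/-! ### Joins and relative complements in a skew Boolean algebra -/

section Algebra

variable {S : Type u} [SkewBooleanAlgebra S]

open SkewLattice SkewBooleanAlgebra

theorem eq_bot_of_proj_eq_bot {x : S} (h : proj x = ⊥) : x = ⊥ := by
  have := (proj_eq_iff (x := x) (y := ⊥)).1 h
  rw [← this.1, inf_bot]

theorem sup_le_of_le {x y c : S} (hx : x ≤ c) (hy : y ≤ c) : x ⊔ y ≤ c := by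
  refine ⟨?_, ?_⟩
  · rw [inf_eq_iff_sup_eq, join_assoc, inf_eq_iff_sup_eq.1 hy.1, inf_eq_iff_sup_eq.1 hx.1]
  · rw [principal_inf_sup c c x y le_rfl hx hy, hx.2, hy.2]

/-- On sections, the join is `b` where `b` is defined and `a` elsewhere; this is the abstract
counterpart. The elements `a \ b` and `b` are disjoint in `S / D`, hence meet in `⊥` on both sides,
so symmetry makes their join commute. Splitting `a` into `a \ b` and `a ⊓ b` and absorbing the
second part into `b` finishes. -/
theorem sup_eq_sup_sdiff (a b : S) : a ⊔ b = b ⊔ (a \ b) := by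
  have hd : proj (a \ b) ⊓ proj b = ⊥ := by rw [proj_sdiff, inf_comm, inf_sdiff_self_right]
  have h₁ : a \ b ⊓ b = ⊥ := eq_bot_of_proj_eq_bot hd
  have h₂ : b ⊓ (a \ b) = ⊥ := eq_bot_of_proj_eq_bot (by rw [proj_inf, inf_comm, hd])
  rw [← (symmetric (a \ b) b).2 (h₁.trans h₂.symm)]
  have h := sup_sdiff a b
  rw [left_handed_inf, principal_sup_comm a _ _ (inf_le_self a b) (sdiff_le a b)] at h
  conv_lhs => rw [← h]
  rw [join_assoc, meet_join_right_self]

theorem sdiff_le_sup (a b : S) : a \ b ≤ a ⊔ b := by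
  rw [sup_eq_sup_sdiff]
  exact self_le_sup _ _

/-! ### Membership in prime filters and the compact open sets `M a` -/

namespace SBAPrimeFilter

/-- A prime filter is recovered from its base and any one of its members, so membership below a
known member is a question in `S / D` only. -/
theorem mem_of_proj_mem (U : SBAPrimeFilter S) {t a : S} (ha : a ∈ U.carrier) (hta : t ≤ a)
    (ht : proj t ∈ U.base.carrier) : t ∈ U.carrier := by
  rw [U.eq_X ha]
  exact ⟨t, ht, hta, le_rfl⟩

/-- Closure under `⊓` alone does not give this, since `a ⊓ b` lies below `a` but in general not
below `b`. It is minimality, through the description `X a F`, that makes a prime filter downward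
directed for the natural order. -/
theorem exists_mem_le_le (U : SBAPrimeFilter S) {a b : S} (ha : a ∈ U.carrier)
    (hb : b ∈ U.carrier) : ∃ t ∈ U.carrier, t ≤ a ∧ t ≤ b := by
  rw [U.eq_X ha] at hb
  obtain ⟨t, h₁, h₂, h₃⟩ := hb
  exact ⟨t, U.mem_of_proj_mem ha h₂ h₁, h₂, h₃⟩

/-- Downward directedness supplies a member below both elements, and the greatest lower bound lies
above it. Thus `∩` becomes intersection of the sets `M a`. -/
theorem mem_iff_of_isGLB (U : SBAPrimeFilter S) {a b c : S} (h : IsGLB {a, b} c) :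
    c ∈ U.carrier ↔ a ∈ U.carrier ∧ b ∈ U.carrier := by
  constructor
  · intro hc
    exact ⟨U.minimal.1.1.mem_of_le _ _ hc (h.1 (by simp)),
      U.minimal.1.1.mem_of_le _ _ hc (h.1 (by simp))⟩
  · rintro ⟨ha, hb⟩
    obtain ⟨t, ht, hta, htb⟩ := U.exists_mem_le_le ha hb
    refine U.minimal.1.1.mem_of_le _ _ ht (h.2 ?_)
    rintro _ (rfl | rfl)
    · exact hta
    · exact htb

/-- This and the analogues for `\` and `⊔` reproduce the formulas defining the operations on
sections, with the base of `U` testing the domain; they make `M` a homomorphism. -/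
theorem mem_inf_iff (U : SBAPrimeFilter S) {a b : S} :
    a ⊓ b ∈ U.carrier ↔ a ∈ U.carrier ∧ proj b ∈ U.base.carrier := by
  constructor
  · intro h
    exact ⟨U.minimal.1.1.mem_of_le _ _ h (inf_le_self a b),
      ((U.base.mem_inf_iff (a := proj a) (b := proj b)).1 (U.proj_mem h)).2⟩
  · rintro ⟨ha, hb⟩
    exact U.mem_of_proj_mem ha (inf_le_self a b) (U.base.mem_inf_iff.2 ⟨U.proj_mem ha, hb⟩)

theorem mem_sdiff_iff (U : SBAPrimeFilter S) {a b : S} :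
    a \ b ∈ U.carrier ↔ a ∈ U.carrier ∧ proj b ∉ U.base.carrier := by
  constructor
  · intro h
    exact ⟨U.minimal.1.1.mem_of_le _ _ h (sdiff_le a b),
      ((U.base.sdiff_mem_iff (a := proj a) (b := proj b)).1 (U.proj_mem h)).2⟩
  · rintro ⟨ha, hb⟩
    exact U.mem_of_proj_mem ha (sdiff_le a b) (U.base.sdiff_mem_iff.2 ⟨U.proj_mem ha, hb⟩)

theorem mem_sup_iff (U : SBAPrimeFilter S) {a b : S} :
    a ⊔ b ∈ U.carrier ↔ b ∈ U.carrier ∨ (a ∈ U.carrier ∧ proj b ∉ U.base.carrier) := by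
  constructor
  · intro h
    by_cases hb : proj b ∈ U.base.carrier
    · exact Or.inl (U.mem_of_proj_mem h (self_le_sup a b) hb)
    · have ha := ((U.base.mem_sup_iff (a := proj a) (b := proj b)).1 (U.proj_mem h)).resolve_right hb
      exact Or.inr (U.mem_sdiff_iff.1 (U.mem_of_proj_mem h (sdiff_le_sup a b)
        (U.base.sdiff_mem_iff.2 ⟨ha, hb⟩)))
  · rintro (h | h)
    · exact U.minimal.1.1.mem_of_le _ _ h (self_le_sup a b)
    · exact U.minimal.1.1.mem_of_le _ _ (U.mem_sdiff_iff.2 h) (sdiff_le_sup a b)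

/-- Over each `F` containing `proj a`, the prime filter through `a` also contains `b`, so some `t`
below both has its class in `F`. Finitely many such `t` cover the compact set `M' (proj a)`. Their
join is still below `a` and `b`, and has the class of `a`. -/
theorem le_of_M_subset {a b : S} (h : M a ⊆ M b) : a ≤ b := by
  obtain ⟨t, hta, htb, ht⟩ : ∃ t, t ≤ a ∧ t ≤ b ∧
      BAPrimeFilter.M' (proj a) ⊆ BAPrimeFilter.M' (proj t) := by
    refine (BAPrimeFilter.isCompact_M' (proj a)).induction_on
      (p := fun K => ∃ t, t ≤ a ∧ t ≤ b ∧ K ⊆ BAPrimeFilter.M' (proj t))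
      ⟨⊥, ⟨bot_inf a, inf_bot a⟩, ⟨bot_inf b, inf_bot b⟩, Set.empty_subset _⟩
      (fun _ _ hst ⟨t, h₁, h₂, h₃⟩ => ⟨t, h₁, h₂, hst.trans h₃⟩) ?_ ?_
    · rintro _ _ ⟨t, h₁, h₂, h₃⟩ ⟨t', h₁', h₂', h₃'⟩
      exact ⟨t ⊔ t', sup_le_of_le h₁ h₁', sup_le_of_le h₂ h₂',
        Set.union_subset
          (fun F hF => (F.mem_sup_iff (a := proj t) (b := proj t')).2 (Or.inl (h₃ hF)))
          fun F hF => (F.mem_sup_iff (a := proj t) (b := proj t')).2 (Or.inr (h₃' hF))⟩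
    · intro F hF
      have ha : mk' a F hF ∈ M a := mem_mk' a F hF
      obtain ⟨t, ht, hta, htb⟩ := (mk' a F hF).exists_mem_le_le ha (h ha)
      exact ⟨_, mem_nhdsWithin_of_mem_nhds ((BAPrimeFilter.isOpen_M' (proj t)).mem_nhds
        ((mk' a F hF).proj_mem ht)), t, hta, htb, le_rfl⟩
  rw [BAPrimeFilter.M'_subset_iff] at ht
  -- Below `a` an element is determined by its class, so `t = a`, and `t ≤ b` becomes the claim.
  rwa [← eq_of_le_of_proj_eq hta le_rfl (le_antisymm (proj_mono hta) ht)]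

/-- The map `F ↦ mk' a F` is a continuous section with image `M a`, so compactness passes from `M'
(proj a)`. -/
theorem isCompact_M (a : S) : IsCompact (M a) := by
  let s : BAPrimeFilter.M' (proj a) → SBAPrimeFilter S := fun F => mk' a F.1 F.2
  have hs : Continuous s := by
    rw [isTopologicalBasis.continuous_iff]
    rintro _ ⟨c, rfl⟩
    refine isOpen_iff_forall_mem_open.2 fun F hF => ?_
    obtain ⟨t, h₁, h₂, h₃⟩ := hF
    exact ⟨Subtype.val ⁻¹' BAPrimeFilter.M' (proj t), fun G hG => ⟨t, hG, h₂, h₃⟩,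
      (BAPrimeFilter.isOpen_M' _).preimage continuous_subtype_val, h₁⟩
  have hr : Set.range s = M a := by
    ext U
    constructor
    · rintro ⟨F, rfl⟩
      exact mem_mk' a F.1 F.2
    · intro hU
      exact ⟨⟨U.base, U.proj_mem hU⟩, eq_of_mem rfl (mem_mk' _ _ _) hU⟩
  have := isCompact_iff_compactSpace.1 (BAPrimeFilter.isCompact_M' (proj a))
  exact hr ▸ isCompact_range hs

/-- A compact open set on which the covering map is injective is of the form `M a`. -/
theorem exists_M_eq {A : Set (SBAPrimeFilter S)} (hA : IsOpen A) (hA' : IsCompact A)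
    (hinj : Set.InjOn base A) : ∃ a, M a = A := by
  obtain ⟨a, h₁, h₂⟩ : ∃ a, A ⊆ M a ∧ M a ⊆ A := by
    refine hA'.induction_on (p := fun K => ∃ a, K ⊆ M a ∧ M a ⊆ A)
      ⟨⊥, Set.empty_subset _, fun U hU => (U.base.bot_not_mem (U.proj_mem hU)).elim⟩
      (fun _ _ hst ⟨a, h₁, h₂⟩ => ⟨a, hst.trans h₁, h₂⟩) ?_ ?_
    · rintro _ _ ⟨a, h₁, h₂⟩ ⟨b, h₁', h₂'⟩
      refine ⟨a ⊔ b, Set.union_subset (fun U hU => U.mem_sup_iff.2 ?_)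
        fun U hU => U.mem_sup_iff.2 (Or.inl (h₁' hU)), fun U hU => ?_⟩
      · by_cases hb : proj b ∈ U.base.carrier
        · left
          -- Over this point the join takes the value of `b`. That value and `U` both lie in `A`,
          -- where the covering map is injective, so they agree and nothing of `M a` is lost.
          have hm : mk' b U.base hb ∈ M b := mem_mk' b U.base hb
          rwa [← hinj (h₂' hm) (h₂ (h₁ hU)) rfl]
        · exact Or.inr ⟨h₁ hU, hb⟩
      · exact (U.mem_sup_iff.1 hU).elim (fun h => h₂' h) fun h => h₂ h.1
    · intro U hU
      obtain ⟨_, ⟨a, rfl⟩, haU, haA⟩ := isTopologicalBasis.exists_subset_of_mem_open hU hA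
      exact ⟨_, mem_nhdsWithin_of_mem_nhds ((isOpen_M a).mem_nhds haU), a, le_rfl, haA⟩
  exact ⟨a, h₂.antisymm h₁⟩

end SBAPrimeFilter

/-! ### The representation of `S` by compact clopen sections -/

open SBAPrimeFilter

/-- The section `M a` of the dual étale space. -/
def toCSec (a : S) : CSec (dualEtale S) where
  carrier := M a
  isSection := csec_iff.2 ⟨isOpen_M a, isCompact_M a, fun _ hU _ hV h => eq_of_mem h hU hV⟩

theorem dom_toCSec (a : S) : (toCSec a).dom = BAPrimeFilter.M' (proj a) := base_image_M a

theorem mem_dom_toCSec {a : S} {F : BAPrimeFilter (MaxLat S)} :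
    F ∈ (toCSec a).dom ↔ proj a ∈ F.carrier := by
  rw [dom_toCSec]
  rfl

variable (S) in
/-- The homomorphism `a ↦ M a` into the algebra of compact clopen sections. -/
def unitHom : SBAHom S (CSec (dualEtale S)) where
  toFun := toCSec
  map_inf _ _ := CSec.ext_iff'.2 fun U =>
    (mem_inf_iff (S := S) U).trans (and_congr Iff.rfl mem_dom_toCSec.symm)
  map_sup _ _ := CSec.ext_iff'.2 fun U =>
    (mem_sup_iff (S := S) U).trans
      (or_congr Iff.rfl (and_congr Iff.rfl (not_congr mem_dom_toCSec.symm)))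
  map_sdiff _ _ := CSec.ext_iff'.2 fun U =>
    (mem_sdiff_iff (S := S) U).trans (and_congr Iff.rfl (not_congr mem_dom_toCSec.symm))
  map_bot := CSec.ext_iff'.2 fun (U : SBAPrimeFilter S) =>
    ⟨fun h => (U.base.bot_not_mem (U.proj_mem h)).elim, fun h => (CSec.not_mem_bot h).elim⟩

variable (S) in
-- The algebraic half of the duality. It needs no intersections: it holds for every left-handed skew
-- Boolean algebra.
theorem unitHom_bijective : Function.Bijective (unitHom S).toFun := by
  constructor
  · intro a b h
    have h : M a = M b := congrArg CSec.carrier h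
    exact le_antisymm (le_of_M_subset h.subset) (le_of_M_subset h.superset)
  · intro A
    obtain ⟨a, ha⟩ := exists_M_eq A.isOpen A.isCompact A.injOn
    exact ⟨a, CSec.ext ha⟩

/-- Every compact clopen section is some `M a`, and a greatest lower bound `c` of `a` and `b`
satisfies `M c = M a ∩ M b`. -/
theorem hasCompactClopenEqualizers_dualEtale (h : HasFiniteIntersections S) :
    (dualEtale S).HasCompactClopenEqualizers := by
  intro U V hU hU' hV hV' A B hA hB
  obtain ⟨a, ha⟩ := (unitHom_bijective S).2 ⟨A, U, hU, hU', hA⟩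
  obtain ⟨b, hb⟩ := (unitHom_bijective S).2 ⟨B, V, hV, hV', hB⟩
  obtain rfl : M a = A := congrArg CSec.carrier ha
  obtain rfl : M b = B := congrArg CSec.carrier hb
  obtain ⟨c, hc⟩ := h {a, b} (Set.toFinite _) ⟨a, by simp⟩
  have hM : M c = M a ∩ M b := Set.ext fun U => U.mem_iff_of_isGLB hc
  exact hM ▸ (toCSec c).isSection

/-- Naturality of `a ↦ M a`. A prime filter `V` containing the image of `a` comes from the prime
filter through `a` over the pulled-back base: the stalk map sends the latter to a filter over
`V.base` containing the same element, hence to `V`. -/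
theorem SBAHom.mapSec_dualHom_toCSec {T : Type u} [SkewBooleanAlgebra T] (k : SBAHom S T)
    (hk : k.IsProper) (a : S) : (k.dualHom hk).mapSec (toCSec a) = toCSec (k.toFun a) := by
  refine CSec.ext_iff'.2 fun (V : SBAPrimeFilter T) => ⟨?_, fun hV => ?_⟩
  · rintro ⟨F, U, hU, ha, rfl⟩
    exact k.mem_stalkMap hk F U hU ha
  · have ha : proj a ∈ (k.dualBase hk V.base).carrier := V.proj_mem hV
    refine ⟨V.base, mk' a _ ha, rfl, mem_mk' _ _ ha, ?_⟩
    exact eq_of_mem (k.stalkMap_base hk _ _ rfl) (k.mem_stalkMap hk _ _ rfl (mem_mk' _ _ ha)) hV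

end Algebra

end SkewStone

namespace SkewStone

/-! ## Points and germs of an étale space as prime filters -/

section Germs

variable {𝓔 : LCBSh.{u}}

/-! ### Compact clopen sections as bases of the two topologies -/

namespace CSec

/-- The restriction of a section to a clopen set. -/
def restrict (A : CSec 𝓔) (W : Set 𝓔.X) (hW : IsClopen W) : CSec 𝓔 where
  carrier := A.carrier ∩ 𝓔.π ⁻¹' W
  isSection := csec_iff.2
    ⟨A.isOpen.inter (hW.isOpen.preimage 𝓔.isLocalHomeomorph.continuous),
      A.isCompact.inter_right (hW.isClosed.preimage 𝓔.isLocalHomeomorph.continuous),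
      A.injOn.mono Set.inter_subset_left⟩

/-- The compact clopen sections form a base of the topology of `E`. -/
theorem exists_mem_subset {e : 𝓔.E} {O : Set 𝓔.E} (hO : IsOpen O) (he : e ∈ O) :
    ∃ A : CSec 𝓔, e ∈ A.carrier ∧ A.carrier ⊆ O := by
  obtain ⟨A, hA⟩ := exists_mem e
  obtain ⟨W, -, hW, heW, hWO⟩ := 𝓔.isLCB.exists_compact_clopen
    (𝓔.isLocalHomeomorph.isOpenMap _ (A.isOpen.inter hO)) (Set.mem_image_of_mem 𝓔.π ⟨hA, he⟩)
  refine ⟨A.restrict W hW, ⟨hA, heW⟩, ?_⟩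
  rintro a ⟨ha, haW⟩
  obtain ⟨b, ⟨hb, hbO⟩, hab⟩ := hWO haW
  rwa [A.injOn ha hb hab.symm]

theorem exists_mem_dom_subset {x : 𝓔.X} {O : Set 𝓔.X} (hO : IsOpen O) (hx : x ∈ O) :
    ∃ A : CSec 𝓔, x ∈ A.dom ∧ A.dom ⊆ O := by
  obtain ⟨e, rfl⟩ := 𝓔.surjective x
  obtain ⟨A, he, hA⟩ := exists_mem_subset (hO.preimage 𝓔.isLocalHomeomorph.continuous) hx
  exact ⟨A, mem_dom he, Set.image_subset_iff.2 hA⟩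

theorem dom_eq_of_proj_eq {A B : CSec 𝓔} (h : proj A = proj B) : A.dom = B.dom :=
  (proj_le_proj_iff.1 h.le).antisymm (proj_le_proj_iff.1 h.ge)

theorem not_mem_dom_bot {x : 𝓔.X} : x ∉ (⊥ : CSec 𝓔).dom := fun ⟨_, h, _⟩ => not_mem_bot h

/-- A germ in both sections lies on a small compact clopen section inside their open intersection.
That section is a lower bound, so a greatest lower bound must contain the germ. -/
theorem mem_of_isGLB {A B C : CSec 𝓔} (h : IsGLB {A, B} C) {e : 𝓔.E} :
    e ∈ C.carrier ↔ e ∈ A.carrier ∧ e ∈ B.carrier := by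
  constructor
  · intro he
    exact ⟨le_iff_subset.1 (h.1 (by simp)) he, le_iff_subset.1 (h.1 (by simp)) he⟩
  · intro he
    obtain ⟨D, heD, hD⟩ := exists_mem_subset (A.isOpen.inter B.isOpen) he
    refine le_iff_subset.1 (h.2 ?_) heD
    rintro _ (rfl | rfl)
    · exact le_iff_subset.2 fun a ha => (hD ha).1
    · exact le_iff_subset.2 fun a ha => (hD ha).2

end CSec

/-- The prime filter of the compact clopen sets containing `x`. -/
def pointFilter (x : 𝓔.X) : BAPrimeFilter (MaxLat (CSec 𝓔)) where
  carrier := {c | ∃ A : CSec 𝓔, proj A = c ∧ x ∈ A.dom}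
  nonempty := by
    obtain ⟨A, hA, -⟩ := CSec.exists_mem_dom_subset isOpen_univ (Set.mem_univ x)
    exact ⟨_, A, rfl, hA⟩
  mem_of_le := by
    rintro _ b ⟨A, rfl, hA⟩ h
    obtain ⟨B, rfl⟩ := proj_surjective b
    exact ⟨B, rfl, CSec.proj_le_proj_iff.1 h hA⟩
  inf_mem := by
    rintro _ _ ⟨A, rfl, hA⟩ ⟨B, rfl, hB⟩
    exact ⟨A ⊓ B, rfl, CSec.mem_dom_inf.2 ⟨hA, hB⟩⟩
  bot_not_mem := by
    rintro ⟨A, h, hA⟩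
    obtain rfl := eq_bot_of_proj_eq_bot h
    exact CSec.not_mem_dom_bot hA
  mem_or_mem := by
    rintro a b ⟨C, h, hC⟩
    obtain ⟨A, rfl⟩ := proj_surjective a
    obtain ⟨B, rfl⟩ := proj_surjective b
    rw [← proj_sup] at h
    rw [CSec.dom_eq_of_proj_eq h, CSec.mem_dom_sup] at hC
    exact hC.imp (fun h => ⟨A, rfl, h⟩) fun h => ⟨B, rfl, h⟩

theorem proj_mem_pointFilter {x : 𝓔.X} {A : CSec 𝓔} :
    proj A ∈ (pointFilter x).carrier ↔ x ∈ A.dom :=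
  ⟨fun ⟨_, h, hB⟩ => CSec.dom_eq_of_proj_eq h ▸ hB, fun h => ⟨A, rfl, h⟩⟩

theorem pointFilter_injective : Function.Injective (pointFilter : 𝓔.X → _) := by
  intro x y h
  by_contra hxy
  have := 𝓔.isLCB.t2
  obtain ⟨A, hx, hA⟩ := CSec.exists_mem_dom_subset isOpen_compl_singleton
    (show x ∈ ({y}ᶜ : Set 𝓔.X) from hxy)
  exact hA (proj_mem_pointFilter.1 (h ▸ proj_mem_pointFilter.2 hx)) rfl

/-- The domains of the sections whose classes lie in `F` form a directed family of nonempty compact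
closed sets, so they have a common point. If that point lay in the domain of `A` with class outside
`F`, then `A₀ \ A` would have its class in `F` but miss the point. -/
theorem pointFilter_surjective : Function.Surjective (pointFilter : 𝓔.X → _) := by
  intro F
  have := 𝓔.isLCB.t2
  obtain ⟨c, hc⟩ := F.nonempty
  obtain ⟨A₀, rfl⟩ := proj_surjective c
  let ι := {A : CSec 𝓔 // proj A ∈ F.carrier}
  have : Nonempty ι := ⟨⟨A₀, hc⟩⟩
  obtain ⟨x, hx⟩ := IsCompact.nonempty_iInter_of_directed_nonempty_isCompact_isClosed
    (fun A : ι => A.1.dom)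
    (fun A B => ⟨⟨A.1 ⊓ B.1, F.inf_mem _ _ A.2 B.2⟩, fun _ h => (CSec.mem_dom_inf.1 h).1,
      fun _ h => (CSec.mem_dom_inf.1 h).2⟩)
    (fun A => by
      by_contra h
      have hA : A.1 = ⊥ := CSec.ext_iff'.2 fun e =>
        ⟨fun he => (h ⟨_, CSec.mem_dom he⟩).elim, fun he => (CSec.not_mem_bot he).elim⟩
      exact F.bot_not_mem (by rw [← proj_bot, ← hA]; exact A.2))
    (fun A => A.1.dom_spec.1) (fun A => A.1.dom_spec.2.1.isClosed)
  rw [Set.mem_iInter] at hx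
  refine ⟨x, BAPrimeFilter.ext (Set.ext fun c => ?_)⟩
  obtain ⟨A, rfl⟩ := proj_surjective c
  rw [proj_mem_pointFilter]
  refine ⟨fun hA => ?_, fun hA => hx ⟨A, hA⟩⟩
  by_contra hF
  exact (CSec.mem_dom_sdiff.1 (hx ⟨A₀ \ A, F.sdiff_mem hc hF⟩)).2 hA

theorem isHomeomorph_pointFilter : IsHomeomorph (pointFilter : 𝓔.X → _) where
  continuous := by
    rw [BAPrimeFilter.isTopologicalBasis.continuous_iff]
    rintro _ ⟨c, rfl⟩
    obtain ⟨A, rfl⟩ := proj_surjective c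
    have : pointFilter ⁻¹' BAPrimeFilter.M' (proj A) = A.dom :=
      Set.ext fun x => proj_mem_pointFilter
    rw [this]
    exact A.dom_spec.2.1.isOpen
  isOpenMap := fun O hO => isOpen_iff_forall_mem_open.2 <| by
    rintro _ ⟨x, hx, rfl⟩
    obtain ⟨A, hxA, hA⟩ := CSec.exists_mem_dom_subset hO hx
    refine ⟨BAPrimeFilter.M' (proj A), fun F hF => ?_, BAPrimeFilter.isOpen_M' _,
      proj_mem_pointFilter.2 hxA⟩
    obtain ⟨y, rfl⟩ := pointFilter_surjective F
    exact ⟨y, hA (proj_mem_pointFilter.1 hF), rfl⟩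
  bijective := ⟨pointFilter_injective, pointFilter_surjective⟩

/-- A section below `A` whose domain contains `π e` must pass through `e`; conversely a section
through `e` agrees with `A` on a small compact clopen section through `e`. This identifies the germ
filter as a minimal preprime filter. -/
theorem X_pointFilter {A : CSec 𝓔} {e : 𝓔.E} (he : e ∈ A.carrier) :
    SBAPrimeFilter.X A (pointFilter (𝓔.π e)) = {B | e ∈ B.carrier} := by
  ext B
  constructor
  · rintro ⟨C, hC, hCA, hCB⟩
    exact CSec.le_iff_subset.1 hCB
      ((CSec.mem_iff_of_le hCA).2 ⟨he, proj_mem_pointFilter.1 hC⟩)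
  · intro (hB : e ∈ B.carrier)
    obtain ⟨C, heC, hC⟩ := CSec.exists_mem_subset (A.isOpen.inter B.isOpen) ⟨he, hB⟩
    exact ⟨C, proj_mem_pointFilter.2 (CSec.mem_dom heC), CSec.le_iff_subset.2 fun a ha => (hC ha).1,
      CSec.le_iff_subset.2 fun a ha => (hC ha).2⟩

/-- The prime filter of the compact clopen sections through `e`. -/
def germFilter (e : 𝓔.E) : SBAPrimeFilter (CSec 𝓔) where
  base := pointFilter (𝓔.π e)
  carrier := {A | e ∈ A.carrier}
  minimal := by
    obtain ⟨A, hA⟩ := CSec.exists_mem e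
    rw [← X_pointFilter hA]
    exact SBAPrimeFilter.minimal_X (proj_mem_pointFilter.2 (CSec.mem_dom hA))

theorem mem_germFilter {e : 𝓔.E} {A : CSec 𝓔} : A ∈ (germFilter e).carrier ↔ e ∈ A.carrier :=
  Iff.rfl

theorem germFilter_injective : Function.Injective (germFilter : 𝓔.E → _) := by
  intro e e' h
  obtain ⟨A, hA⟩ := CSec.exists_mem e
  exact A.injOn hA (mem_germFilter.1 (h ▸ mem_germFilter.2 hA))
    (pointFilter_injective (congrArg SBAPrimeFilter.base h))

/-- A prime filter is fixed by its base, which is a point `x`, and by one member `A`; the germ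
sought is the value of `A` at `x`. -/
theorem germFilter_surjective : Function.Surjective (germFilter : 𝓔.E → _) := by
  intro U
  obtain ⟨x, hx⟩ := pointFilter_surjective U.base
  obtain ⟨A, hA⟩ := U.minimal.1.1.nonempty
  have hxA := U.proj_mem hA
  rw [← hx, proj_mem_pointFilter] at hxA
  obtain ⟨e, he, rfl⟩ := hxA
  exact ⟨e, SBAPrimeFilter.eq_of_mem hx (mem_germFilter.2 he) hA⟩

theorem isHomeomorph_germFilter : IsHomeomorph (germFilter : 𝓔.E → _) where
  continuous := by
    rw [SBAPrimeFilter.isTopologicalBasis.continuous_iff]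
    rintro _ ⟨A, rfl⟩
    exact A.isOpen
  isOpenMap := fun O hO => isOpen_iff_forall_mem_open.2 <| by
    rintro _ ⟨e, he, rfl⟩
    obtain ⟨A, heA, hA⟩ := CSec.exists_mem_subset hO he
    refine ⟨SBAPrimeFilter.M A, fun U hU => ?_, SBAPrimeFilter.isOpen_M _, heA⟩
    obtain ⟨e', rfl⟩ := germFilter_surjective U
    exact ⟨e', hA hU, rfl⟩
  bijective := ⟨germFilter_injective, germFilter_surjective⟩

/-! ### Naturality of the point and germ representations -/

variable {𝓑 𝓐 : LCBSh.{u}} (k : LCBSh.Hom 𝓑 𝓐)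

theorem LCBSh.Hom.dualBase_pointFilter (x : 𝓐.X) :
    k.toSBAHom.dualBase k.toSBAHom_isProper (pointFilter x) = pointFilter (k.base x) := by
  refine BAPrimeFilter.ext (Set.ext fun c => ?_)
  obtain ⟨A, rfl⟩ := proj_surjective c
  exact (proj_mem_pointFilter.trans mem_dom_mapSec).trans proj_mem_pointFilter.symm

theorem LCBSh.Hom.base_homeomorph_symm_pointFilter (F : BAPrimeFilter (MaxLat (CSec 𝓐))) :
    k.base (isHomeomorph_pointFilter.homeomorph.symm F) =
      isHomeomorph_pointFilter.homeomorph.symm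
        (k.toSBAHom.dualBase k.toSBAHom_isProper F) := by
  obtain ⟨x, rfl⟩ := isHomeomorph_pointFilter.homeomorph.surjective F
  rw [Homeomorph.symm_apply_apply, eq_comm, Homeomorph.symm_apply_eq]
  exact k.dualBase_pointFilter x

/-- The filter of the image germ lies over `F` and contains the image of every section through `e`;
uniqueness in the definition of the stalk map does the rest. -/
theorem LCBSh.Hom.germFilter_map_eq_stalkMap (F : BAPrimeFilter (MaxLat (CSec 𝓐))) (e : 𝓑.E)
    (h : 𝓑.π e = k.base (isHomeomorph_pointFilter.homeomorph.symm F))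
    (h' : (germFilter e).base = k.toSBAHom.dualBase k.toSBAHom_isProper F) :
    germFilter (k.cohom.map _ e h) =
      k.toSBAHom.stalkMap k.toSBAHom_isProper F (germFilter e) h' := by
  refine (k.toSBAHom.stalkMap_eq k.toSBAHom_isProper F _ h'
    (germFilter (k.cohom.map _ e h)) ?_ fun A hA => ⟨_, e, h, hA, rfl⟩).symm
  change pointFilter (𝓐.π (k.cohom.map _ e h)) = F
  rw [k.cohom.π_map]
  exact isHomeomorph_pointFilter.homeomorph.apply_symm_apply F

end Germs

/-! ## Isomorphisms of étale spaces -/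

/-- The morphism given by homeomorphisms of the total and base spaces that commute with the
covering maps. -/
def LCBSh.Hom.ofHomeomorph {𝓑 𝓐 : LCBSh.{u}} (f : 𝓐.X ≃ₜ 𝓑.X) (g : 𝓑.E ≃ₜ 𝓐.E)
    (h : ∀ b, f (𝓐.π (g b)) = 𝓑.π b) : LCBSh.Hom 𝓑 𝓐 where
  base := f
  base_continuous := f.continuous
  base_proper _ hK := f.isCompact_preimage.2 hK
  cohom :=
    { map := fun _ b _ => g b
      π_map := fun _ b hb => f.injective ((h b).trans hb)
      isSection_map := fun _ _ _ hs =>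
        ⟨g.continuous.comp (hs.continuous.comp
          ((f.continuous.comp continuous_subtype_val).subtype_mk _)),
          fun _ => f.injective ((h _).trans (hs.π_apply _))⟩ }

/-- Compatible homeomorphisms of the total and base spaces give an isomorphism in `ESLCBSE`. -/
def ESLCBSE.isoOfHomeomorph {𝓑 𝓐 : ESLCBSE.{u}} (f : 𝓐.toLCBSh.X ≃ₜ 𝓑.toLCBSh.X)
    (g : 𝓑.toLCBSh.E ≃ₜ 𝓐.toLCBSh.E)
    (h : ∀ b, f (𝓐.toLCBSh.π (g b)) = 𝓑.toLCBSh.π b) : 𝓑 ≅ 𝓐 where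
  hom := ⟨LCBSh.Hom.ofHomeomorph f g h, fun _ _ _ _ _ e => g.injective e⟩
  inv := ⟨LCBSh.Hom.ofHomeomorph f.symm g.symm fun a => by
    rw [f.symm_apply_eq, ← h, g.apply_symm_apply], fun _ _ _ _ _ e => g.symm.injective e⟩
  hom_inv_id := ESLCBSE.Hom.ext (LCBSh.Hom.ext' (fun x => f.apply_symm_apply x)
    fun _ b _ _ => g.symm_apply_apply b)
  inv_hom_id := ESLCBSE.Hom.ext (LCBSh.Hom.ext' (fun x => f.symm_apply_apply x)
    fun _ b _ _ => g.apply_symm_apply b)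

/-! ## Isomorphisms of skew Boolean ∩-algebras -/

/-- Induction on the finite set: adjoining `a` to a nonempty set with greatest lower bound `c`
leaves the same lower bounds as the pair `a`, `c`. -/
theorem HasFiniteIntersections.of_pair {S : Type u} [SkewBooleanAlgebra S]
    (h : ∀ a b : S, ∃ c, IsGLB {a, b} c) : HasFiniteIntersections S := by
  intro s hs hne
  induction s, hs using Set.Finite.induction_on with
  | empty => exact (Set.not_nonempty_empty hne).elim
  | @insert a s _ _ ih =>
    obtain rfl | hs := s.eq_empty_or_nonempty
    · exact ⟨a, by simp⟩
    obtain ⟨c, hc⟩ := ih hs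
    obtain ⟨d, hd⟩ := h a c
    refine ⟨d, ?_⟩
    rw [IsGLB, lowerBounds_insert, lowerBounds_singleton] at hd
    rwa [IsGLB, lowerBounds_insert, hc.lowerBounds_eq]

namespace SBAHom

variable {S T : Type u} [SkewBooleanAlgebra S] [SkewBooleanAlgebra T]

/-- The inverse of a bijective homomorphism. -/
noncomputable def symm (k : SBAHom S T) (hk : Function.Bijective k.toFun) : SBAHom T S where
  toFun := Function.surjInv hk.2
  map_inf a b := hk.1 (by simp only [k.map_inf, Function.surjInv_eq])
  map_sup a b := hk.1 (by simp only [k.map_sup, Function.surjInv_eq])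
  map_sdiff a b := hk.1 (by simp only [k.map_sdiff, Function.surjInv_eq])
  map_bot := hk.1 (by simp only [k.map_bot, Function.surjInv_eq])

theorem apply_symm (k : SBAHom S T) (hk : Function.Bijective k.toFun) (b : T) :
    k.toFun ((k.symm hk).toFun b) = b := Function.surjInv_eq hk.2 b

theorem symm_apply (k : SBAHom S T) (hk : Function.Bijective k.toFun) (a : S) :
    (k.symm hk).toFun (k.toFun a) = a := hk.1 (k.apply_symm hk _)

theorem bijective_symm (k : SBAHom S T) (hk : Function.Bijective k.toFun) :
    Function.Bijective (k.symm hk).toFun :=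
  ⟨fun a b h => by rw [← k.apply_symm hk a, h, k.apply_symm],
    fun a => ⟨k.toFun a, k.symm_apply hk a⟩⟩

theorem isProper_of_surjective (k : SBAHom S T) (hk : Function.Surjective k.toFun) :
    k.IsProper := by
  intro c
  obtain ⟨b, rfl⟩ := proj_surjective c
  obtain ⟨a, rfl⟩ := hk b
  exact ⟨proj a, le_rfl⟩

theorem le_iff_of_injective (k : SBAHom S T) (hk : Function.Injective k.toFun) {a b : S} :
    k.toFun a ≤ k.toFun b ↔ a ≤ b := by
  rw [le_iff, le_iff, ← k.map_inf, ← k.map_inf, hk.eq_iff, hk.eq_iff]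

theorem isGLB_of_bijective (k : SBAHom S T) (hk : Function.Bijective k.toFun) {a b c : S}
    (h : IsGLB {a, b} c) : IsGLB {k.toFun a, k.toFun b} (k.toFun c) := by
  constructor
  · rintro _ (rfl | rfl) <;> exact k.map_le (h.1 (by simp))
  · intro d hd
    obtain ⟨d, rfl⟩ := hk.2 d
    rw [k.le_iff_of_injective hk.1]
    refine h.2 ?_
    rintro _ (rfl | rfl) <;> exact (k.le_iff_of_injective hk.1).1 (hd (by simp))

end SBAHom

namespace LSBIA

/-- A bijective homomorphism of skew Boolean algebras preserves intersections. -/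
def homOfBijective {S T : LSBIA.{u}} (k : SBAHom S.toSkewB.carrier T.toSkewB.carrier)
    (hk : Function.Bijective k.toFun) : S ⟶ T :=
  ⟨⟨k, k.isProper_of_surjective hk.2⟩, fun a b =>
    (k.isGLB_of_bijective hk (S.isGLB_inter a b)).unique (T.isGLB_inter _ _)⟩

/-- A bijective homomorphism of skew Boolean algebras is an isomorphism in `LSBIA`. -/
noncomputable def isoOfBijective {S T : LSBIA.{u}}
    (k : SBAHom S.toSkewB.carrier T.toSkewB.carrier) (hk : Function.Bijective k.toFun) :
    S ≅ T where
  hom := homOfBijective k hk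
  inv := homOfBijective (k.symm hk) (k.bijective_symm hk)
  hom_inv_id := LSBIA.Hom.ext (SkewB.Hom.ext (SBAHom.ext (funext (k.symm_apply hk))))
  inv_hom_id := LSBIA.Hom.ext (SkewB.Hom.ext (SBAHom.ext (funext (k.apply_symm hk))))

end LSBIA

/-! ## The restricted functors and the equivalence -/

/-- If two germs have the same image, choose `a` and `b` in them. The common image contains the
images of `a` and `b`, hence their intersection, which is the image of `a ∩ b`. So the class of `a ∩
b` lies in the common base. -/
theorem LSBIA.dualHom_isInjective {S T : LSBIA.{u}} (k : S ⟶ T) :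
    (k.hom.hom.dualHom k.hom.proper).cohom.IsInjective := by
  intro F U U' hU hU' e
  change k.hom.hom.stalkMap k.hom.proper F U hU = k.hom.hom.stalkMap k.hom.proper F U' hU' at e
  obtain ⟨a, ha⟩ := U.minimal.1.1.nonempty
  obtain ⟨b, hb⟩ := U'.minimal.1.1.nonempty
  have hka := k.hom.hom.mem_stalkMap k.hom.proper F U hU ha
  have hkb := k.hom.hom.mem_stalkMap k.hom.proper F U' hU' hb
  rw [← e] at hkb
  have hab := (SBAPrimeFilter.mem_iff_of_isGLB _ (T.isGLB_inter _ _)).2 ⟨hka, hkb⟩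
  rw [← k.map_inter] at hab
  have hF : proj (S.inter a b) ∈ (k.hom.hom.dualBase k.hom.proper F).carrier := by
    have h := SBAPrimeFilter.proj_mem _ hab
    have hbase : (k.hom.hom.stalkMap k.hom.proper F U hU).base = F :=
      k.hom.hom.stalkMap_base k.hom.proper F U hU
    rw [hbase] at h
    exact h
  have hS := S.isGLB_inter a b
  -- Being below both `a` and `b`, the element `a ∩ b` belongs to both prime filters, and one shared
  -- member over the same base makes them equal.
  exact SBAPrimeFilter.eq_of_mem (hU.trans hU'.symm)
    (U.mem_of_proj_mem ha (hS.1 (by simp)) (by rw [show U.base = _ from hU]; exact hF))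
    (U'.mem_of_proj_mem hb (hS.1 (by simp)) (by rw [show U'.base = _ from hU']; exact hF))

/-- The equalizer condition says precisely that `A ∩ B` is an element of the algebra, and the order
there is inclusion. -/
theorem ESLCBSE.exists_isGLB (𝓔 : ESLCBSE.{u}) (A B : CSec 𝓔.toLCBSh) :
    ∃ C, IsGLB {A, B} C := by
  obtain ⟨hA, hA', hA''⟩ := A.dom_spec
  obtain ⟨hB, hB', hB''⟩ := B.dom_spec
  refine ⟨⟨A.carrier ∩ B.carrier, 𝓔.equalizers _ _ hA hA' hB hB' _ _ hA'' hB''⟩, ?_, ?_⟩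
  · rintro _ (rfl | rfl)
    · exact CSec.le_iff_subset.2 Set.inter_subset_left
    · exact CSec.le_iff_subset.2 Set.inter_subset_right
  · intro D hD
    exact CSec.le_iff_subset.2 (Set.subset_inter (CSec.le_iff_subset.1 (hD (by simp)))
      (CSec.le_iff_subset.1 (hD (by simp))))

/-- The restriction of `ES` to skew Boolean ∩-algebras. -/
noncomputable def restrictedES : LSBIA.{u} ⥤ ESLCBSE.{u} where
  obj S := ⟨ES.obj S.toSkewB, hasCompactClopenEqualizers_dualEtale S.hasInter⟩
  map k := ⟨ES.map k.hom, LSBIA.dualHom_isInjective k⟩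
  map_id S := ESLCBSE.Hom.ext (ES.map_id S.toSkewB)
  map_comp k l := ESLCBSE.Hom.ext (ES.map_comp k.hom l.hom)

/-- The ∩-algebra of compact clopen sections. -/
def ESLCBSE.sections (𝓔 : ESLCBSE.{u}) : LSBIA.{u} where
  toSkewB := SB.obj 𝓔.toLCBSh
  hasInter := .of_pair 𝓔.exists_isGLB

theorem ESLCBSE.mem_inter {𝓔 : ESLCBSE.{u}} {A B : CSec 𝓔.toLCBSh} {e : 𝓔.toLCBSh.E} :
    e ∈ CSec.carrier (𝓔.sections.inter A B) ↔ e ∈ A.carrier ∧ e ∈ B.carrier :=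
  CSec.mem_of_isGLB (𝓔.sections.isGLB_inter A B)

/-- A germ on both image sections comes from germs of `A` and of `B` in the same stalk; injectivity
of the stalk map identifies these two germs, which puts them on the intersection. -/
theorem ESLCBSE.mapSec_inter {𝓑 𝓐 : ESLCBSE.{u}} (k : 𝓑 ⟶ 𝓐) (A B : CSec 𝓑.toLCBSh) :
    LCBSh.Hom.mapSec k.hom (𝓑.sections.inter A B) =
      𝓐.sections.inter (LCBSh.Hom.mapSec k.hom A) (LCBSh.Hom.mapSec k.hom B) := by
  refine CSec.ext_iff'.2 fun e => Iff.trans (mem_mapSec.trans ⟨?_, ?_⟩) mem_inter.symm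
  · rintro ⟨a, h, ha, he⟩
    have hab := mem_inter.1 ha
    exact ⟨mem_mapSec.2 ⟨a, h, hab.1, he⟩, mem_mapSec.2 ⟨a, h, hab.2, he⟩⟩
  · rintro ⟨hA, hB⟩
    obtain ⟨a, h, ha, he⟩ := mem_mapSec.1 hA
    obtain ⟨b, h', hb, he'⟩ := mem_mapSec.1 hB
    obtain rfl := k.injective _ a b h h' (he.trans he'.symm)
    exact ⟨a, h, mem_inter.2 ⟨ha, hb⟩, he⟩

/-- The restriction of `SB` to étale spaces with compact clopen equalizers. -/
def restrictedSB : ESLCBSE.{u} ⥤ LSBIA.{u} where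
  obj 𝓔 := 𝓔.sections
  map k := ⟨SB.map k.hom, ESLCBSE.mapSec_inter k⟩
  map_id 𝓔 := LSBIA.Hom.ext (SB.map_id 𝓔.toLCBSh)
  map_comp k l := LSBIA.Hom.ext (SB.map_comp k.hom l.hom)

/-- The natural isomorphism `a ↦ M a`. -/
noncomputable def unitIso : 𝟭 LSBIA.{u} ≅ restrictedES ⋙ restrictedSB :=
  NatIso.ofComponents
    (fun S => LSBIA.isoOfBijective (T := (restrictedES ⋙ restrictedSB).obj S)
      (unitHom S.toSkewB.carrier) (unitHom_bijective _))
    (fun k => LSBIA.Hom.ext (SkewB.Hom.ext (SBAHom.ext (funext fun a =>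
      (k.hom.hom.mapSec_dualHom_toCSec k.hom.proper a).symm))))

/-- The natural isomorphism sending each germ to the prime filter of the sections through it. -/
noncomputable def germIso : 𝟭 ESLCBSE.{u} ≅ restrictedSB ⋙ restrictedES :=
  NatIso.ofComponents
    (fun 𝓔 => ESLCBSE.isoOfHomeomorph (𝓐 := (restrictedSB ⋙ restrictedES).obj 𝓔)
      -- The inverse appears because a morphism runs against its base map: germs go forward to prime
      -- filters, while points of the spectrum go back to points of the space.
      (isHomeomorph_pointFilter (𝓔 := 𝓔.toLCBSh)).homeomorph.symm
      (isHomeomorph_germFilter (𝓔 := 𝓔.toLCBSh)).homeomorph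
      (fun _ => (Homeomorph.symm_apply_eq _).2 rfl))
    (fun k => ESLCBSE.Hom.ext (LCBSh.Hom.ext'
      (LCBSh.Hom.base_homeomorph_symm_pointFilter k.hom)
      fun F e h h' => LCBSh.Hom.germFilter_map_eq_stalkMap k.hom F e h
        ((Homeomorph.symm_apply_eq isHomeomorph_pointFilter.homeomorph).1 h'.symm).symm))

end SkewStone

theorem theorem1p3 :
    ∃ e : SkewStone.LSBIA.{u} ≌ SkewStone.ESLCBSE.{u},
      e.functor ⋙ SkewStone.ESLCBSE.incl = SkewStone.LSBIA.incl ⋙ SkewStone.ES ∧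
      e.inverse ⋙ SkewStone.LSBIA.incl = SkewStone.ESLCBSE.incl ⋙ SkewStone.SB :=
  -- The two natural isomorphisms need no compatibility: `Equivalence.mk` adjusts them to satisfy
  -- the triangle identity and leaves the functors unchanged, so both restriction equations hold by
  -- `rfl`.
  ⟨.mk SkewStone.restrictedES SkewStone.restrictedSB SkewStone.unitIso SkewStone.germIso.symm,
    rfl, rfl⟩
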